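/- Let $P\subset\mathbb R^2$ be an orthogonal polygon, i.e. a nonempty finite union of non-degenerate closed axis-parallel rectangles whose boundary $\delta P$ consists of pairwise disjoint simple closed rectilinear curves (holes and several components are allowed). Its edges are the maximal segments contained in $\delta P$. Let $k,m\ge 0$ be integers. A sliding $k$-transmitter is a non-degenerate horizontal or vertical segment $s\subseteq P$ (it may run along edges). It sees a point $p\in P$ if the perpendicular from $p$ onto the line of $s$ ends at a point $q\in s$ and the segment $\overline{pq}$ crosses $\delta P$ at most $k$ times. Here each passage of $\overline{pq}$ through the exterior of $P$ counts as two crossings (leaving and entering $P$), and touching $\delta P$ or running along it without changing sides is not a crossing; precisely, the number of crossings is $2r$ for the largest $r$ such that $\overline{pq}$ contains $r$ points outside $P$ any two of which are separated on $\overline{pq}$ by an interior point of $P$. A set of transmitters guards $P$ if every point of $P$ is seen by one of them. To extend a horizontal segment $s$ means to expand it to the left and to the right, on each side until a vertical edge is hit from the strict inside of $P$ for the $(\lfloor k/2\rfloor+1)$st time, stopping at the last such hit if there are fewer (and not expanding at all if there is none). The horizontal partition-segments are the extensions of the horizontal edges of $P$; they split the interior of $P$ into open rectangles, the horizontal slices.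 For each horizontal slice $\sigma$ fix any horizontal segment inside $\sigma$; its extension is the slice-segment of $\sigma$. Vertical slices and slice-segments are defined analogously. A pixel is a nonempty intersection $\sigma_H\cap\sigma_V$ of a horizontal and a vertical slice; its cross is the point where the slice-segments of $\sigma_H$ and $\sigma_V$, which are said to support the cross, intersect. A guard-segment is a maximal horizontal or vertical segment contained in $P$ that contains an edge of $P$. A guard-segment $g$ hits a cross if it meets the slice-segment supporting the cross that is perpendicular to $g$. Then, for every choice of the segments that define the slice-segments, the following are equivalent: 1. there is a set of at most $m$ sliding $k$-transmitters that guards $P$; 2. there is a set of at most $m$ guard-segments such that every cross is hit by some guard-segment of the set. -/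

import Mathlib

namespace SlidingTransmitter

/-- The two axis-parallel directions. -/
inductive Dir
  | horizontal
  | vertical

/-- The perpendicular direction. -/
def Dir.perp : Dir → Dir
  | .horizontal => .vertical
  | .vertical => .horizontal

/-- The point with coordinate `t` on the line of direction `d` at level `c`: the line `y = c` if
`d` is horizontal, the line `x = c` if `d` is vertical. -/
def pt : Dir → ℝ → ℝ → ℝ × ℝ
  | .horizontal, c, t => (t, c)
  | .vertical, c, t => (c, t)

/-- The coordinate of a point that varies along direction `d`. -/
def coord : Dir → ℝ × ℝ → ℝ
  | .horizontal, p => p.1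
  | .vertical, p => p.2

/-- A non-degenerate horizontal or vertical line segment. -/
@[ext]
structure Seg where
  dir : Dir
  level : ℝ
  lo : ℝ
  hi : ℝ
  lo_lt_hi : lo < hi

/-- The set of points of a segment (endpoints included). -/
def Seg.carrier (s : Seg) : Set (ℝ × ℝ) := pt s.dir s.level '' Set.Icc s.lo s.hi

/-- An orthogonal polygon, as a closed region of the plane: a finite union of non-degenerate
closed axis-parallel rectangles (`Set.Icc a b` is the rectangle with lower left corner `a` and upper
right corner `b`) whose boundary does not touch itself, so that the boundary consists of pairwise
disjoint simple closed rectilinear curves.  Holes are allowed, and so are several components. -/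
structure IsOrthogonalPolygon (P : Set (ℝ × ℝ)) : Prop where
  nonempty : P.Nonempty
  finite_union : ∃ F : Finset ((ℝ × ℝ) × (ℝ × ℝ)),
    (∀ r ∈ F, r.1.1 < r.2.1 ∧ r.1.2 < r.2.2) ∧ P = ⋃ r ∈ F, Set.Icc r.1 r.2
  no_pinch : ∀ x y ε : ℝ, 0 < ε →
    ¬ (Set.Ioo x (x + ε) ×ˢ Set.Ioo y (y + ε) ⊆ P ∧
       Set.Ioo (x - ε) x ×ˢ Set.Ioo (y - ε) y ⊆ P ∧
       Disjoint (Set.Ioo (x - ε) x ×ˢ Set.Ioo y (y + ε)) P ∧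
       Disjoint (Set.Ioo x (x + ε) ×ˢ Set.Ioo (y - ε) y) P)
  no_pinch' : ∀ x y ε : ℝ, 0 < ε →
    ¬ (Disjoint (Set.Ioo x (x + ε) ×ˢ Set.Ioo y (y + ε)) P ∧
       Disjoint (Set.Ioo (x - ε) x ×ˢ Set.Ioo (y - ε) y) P ∧
       Set.Ioo (x - ε) x ×ˢ Set.Ioo y (y + ε) ⊆ P ∧
       Set.Ioo x (x + ε) ×ˢ Set.Ioo (y - ε) y ⊆ P)

/-- An edge of `P`: a maximal segment contained in the boundary. -/
def IsEdge (P : Set (ℝ × ℝ)) (e : Seg) : Prop :=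
  e.carrier ⊆ frontier P ∧ ∀ s : Seg, s.carrier ⊆ frontier P → e.carrier ⊆ s.carrier → s = e

/-- The carrier of a sliding transmitter: a horizontal or vertical segment in `P`
(it may run along the boundary). -/
def IsTransmitter (P : Set (ℝ × ℝ)) (s : Seg) : Prop := s.carrier ⊆ P

/-- The segment from `p` to `q` passes through the exterior of `P` at least `r` times: it contains,
in this order, `r` points outside `P`, any two of which are separated on the segment by an interior
point of `P`. -/
def HasExteriorPassages (P : Set (ℝ × ℝ)) (p q : ℝ × ℝ) (r : ℕ) : Prop :=
  ∃ t : Fin r → ℝ,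
    (∀ i, t i ∈ Set.Icc (0 : ℝ) 1 ∧ AffineMap.lineMap p q (t i) ∉ P) ∧
    ∀ i j, i < j → ∃ u, t i < u ∧ u < t j ∧ AffineMap.lineMap p q u ∈ interior P

/-- The number of times the segment between two points `p`, `q` of `P` crosses the boundary of `P`.
Each passage through the exterior consists of two crossings (leaving `P` and entering `P`).
Touching the boundary, or running along it, without changing sides is not a crossing. -/
noncomputable def crossings (P : Set (ℝ × ℝ)) (p q : ℝ × ℝ) : ℕ∞ :=
  ⨆ (r : ℕ) (_ : HasExteriorPassages P p q r), ((2 * r : ℕ) : ℕ∞)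

/-- The sliding `k`-transmitter `s` sees `p`: the perpendicular from `p` onto the line of `s` ends on
`s` and crosses the boundary of `P` at most `k` times. -/
def Sees (P : Set (ℝ × ℝ)) (k : ℕ) (s : Seg) (p : ℝ × ℝ) : Prop :=
  coord s.dir p ∈ Set.Icc s.lo s.hi ∧ crossings P p (pt s.dir s.level (coord s.dir p)) ≤ k

/-- The set `S` of sliding `k`-transmitters guards `P`. -/
def Guards (P : Set (ℝ × ℝ)) (k : ℕ) (S : Finset Seg) : Prop :=
  ∀ p ∈ P, ∃ s ∈ S, Sees P k s p

/-- Moving along the line of direction `d` at level `c` in increasing direction, one hits at `t` the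
boundary coming from the strict inside of `P` (hence one hits an edge perpendicular to `d`). -/
def HitFwd (P : Set (ℝ × ℝ)) (d : Dir) (c t : ℝ) : Prop :=
  pt d c t ∈ frontier P ∧ ∃ a < t, ∀ u ∈ Set.Ioo a t, pt d c u ∈ interior P

/-- The same when moving in decreasing direction. -/
def HitBwd (P : Set (ℝ × ℝ)) (d : Dir) (c t : ℝ) : Prop :=
  pt d c t ∈ frontier P ∧ ∃ b > t, ∀ u ∈ Set.Ioo t b, pt d c u ∈ interior P

/-- `h` is one of the first `⌊k/2⌋ + 1` hits from the inside after `b` in increasing direction. -/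
def ReachFwd (P : Set (ℝ × ℝ)) (k : ℕ) (d : Dir) (c b h : ℝ) : Prop :=
  b < h ∧ HitFwd P d c h ∧
    {u | b < u ∧ u < h ∧ HitFwd P d c u}.encard < ((k / 2 + 1 : ℕ) : ℕ∞)

/-- `h` is one of the first `⌊k/2⌋ + 1` hits from the inside after `a` in decreasing direction. -/
def ReachBwd (P : Set (ℝ × ℝ)) (k : ℕ) (d : Dir) (c a h : ℝ) : Prop :=
  h < a ∧ HitBwd P d c h ∧
    {u | h < u ∧ u < a ∧ HitBwd P d c u}.encard < ((k / 2 + 1 : ℕ) : ℕ∞)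

/-- The segment obtained by expanding `s` on both sides until a perpendicular edge is hit from the
strict inside of `P` for the `(⌊k/2⌋ + 1)`st time; if there are not enough such hits, the expansion
stops at the last one. -/
def extension (P : Set (ℝ × ℝ)) (k : ℕ) (s : Seg) : Set (ℝ × ℝ) :=
  {p | ∃ a b : ℝ, (a = s.lo ∨ ReachBwd P k s.dir s.level s.lo a) ∧
    (b = s.hi ∨ ReachFwd P k s.dir s.level s.hi b) ∧ p ∈ pt s.dir s.level '' Set.Icc a b}

/-- The interior of `P` without the partition-segments of direction `d`, which are the extensions of
the edges of direction `d`. -/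
def cutInterior (P : Set (ℝ × ℝ)) (k : ℕ) (d : Dir) : Set (ℝ × ℝ) :=
  interior P \ ⋃ (e : Seg) (_ : IsEdge P e ∧ e.dir = d), extension P k e

/-- A slice of direction `d` (an open rectangle): one of the parts into which the partition-segments
of direction `d` split the interior of `P`. -/
def IsSlice (P : Set (ℝ × ℝ)) (k : ℕ) (d : Dir) (σ : Set (ℝ × ℝ)) : Prop :=
  ∃ z ∈ cutInterior P k d, σ = connectedComponentIn (cutInterior P k d) z

/-- `rep` selects in every slice of direction `d` a segment of direction `d` strictly inside. The
slice-segment of the slice `σ` is then `extension P k (rep d σ)`. -/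
def IsSelection (P : Set (ℝ × ℝ)) (k : ℕ) (rep : Dir → Set (ℝ × ℝ) → Seg) : Prop :=
  ∀ d σ, IsSlice P k d σ → (rep d σ).dir = d ∧ (rep d σ).carrier ⊆ σ

/-- A guard-segment: a segment obtained from an edge by extending it inside `P` as far as
possible. -/
def IsGuardSegment (P : Set (ℝ × ℝ)) (g : Seg) : Prop :=
  (∃ e, IsEdge P e ∧ e.carrier ⊆ g.carrier) ∧ g.carrier ⊆ P ∧
    ∀ s : Seg, s.carrier ⊆ P → g.carrier ⊆ s.carrier → s = g

/-- A cross: the point where the slice-segments of a horizontal and a vertical slice that form a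
pixel (i.e. that intersect) meet. -/
structure Cross (P : Set (ℝ × ℝ)) (k : ℕ) (rep : Dir → Set (ℝ × ℝ) → Seg) where
  slice : Dir → Set (ℝ × ℝ)
  isSlice : ∀ d, IsSlice P k d (slice d)
  pixel_nonempty : (slice .horizontal ∩ slice .vertical).Nonempty
  point : ℝ × ℝ
  point_mem : ∀ d, point ∈ extension P k (rep d (slice d))

/-- The slice-segment of direction `d` that supports a cross. -/
def Cross.support {P : Set (ℝ × ℝ)} {k : ℕ} {rep : Dir → Set (ℝ × ℝ) → Seg}
    (c : Cross P k rep) (d : Dir) : Set (ℝ × ℝ) :=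
  extension P k (rep d (c.slice d))

/-- The cross `c` is hit by `g`: `g` meets the supporting slice-segment perpendicular to `g`. -/
def Cross.HitBy {P : Set (ℝ × ℝ)} {k : ℕ} {rep : Dir → Set (ℝ × ℝ) → Seg}
    (c : Cross P k rep) (g : Seg) : Prop :=
  (g.carrier ∩ c.support g.dir.perp).Nonempty

end SlidingTransmitter

namespace SlidingTransmitter

open Set Filter Topology

/-! Both implications rest on one fact: all points of a slice of direction `d` see the same
coordinates along their lines of direction `d` (`IsSlice.visible_iff`). Slices are connected, so it
suffices that visibility is locally constant on `cutInterior` (`eventually_visible_iff`). Let `U`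
and `L` be the traces of `P` just above and just below the line through a point `z`. As far as `U`
and `L` agree, nearby lines show the same picture as the line itself. Where they differ, the line
carries an edge, and since `z` is on no partition-segment, the extension of this edge stops before
`z`: at least `⌊k/2⌋ + 1` hits lie in between. After the last edge before `z` the two sides agree,
so every hit there leads to the exterior. Hence the view from `z` is already blocked inside the
stretch of agreement, and the same block is present on the nearby lines
(`exists_passages_of_disagree`).

The same comparison of hits with passages shows that, among points of `P`, the slice-segment covers
exactly what its slice sees (`Visible.mem_extension`, `visible_of_mem_extension`). Moreover, a point
seen from a slice stays in `P` when it is moved across the slice, so a guard-segment, being maximal,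
contains the whole transversal stretch. Thus a guard-segment that sees one point of a perpendicular
slice meets its slice-segment (`Cross.hitBy_of_visible`), and one that meets the slice-segment sees
the whole slice (`IsGuardSegment.sees_of_nonempty_inter`).

From 1 to 2, each transmitter is pushed sideways inside `P` until it touches an edge and is then
prolonged; it loses no point it saw (`IsTransmitter.exists_guardSegment`). From 2 to 1, the
guard-segments themselves are the transmitters: they see every point lying in slices of both
directions. Such points are dense in `P`, and the set seen by a transmitter is closed. -/

/-! ### Sets of reals that are finite unions of non-degenerate closed intervals -/

/-- The properties of a finite union of non-degenerate compact intervals that matter here. -/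
structure Tame (S : Set ℝ) : Prop where
  isCompact : IsCompact S
  right : ∀ t, (∀ᶠ u in 𝓝[>] t, u ∈ S) ∨ ∀ᶠ u in 𝓝[>] t, u ∉ S
  left : ∀ t, (∀ᶠ u in 𝓝[<] t, u ∈ S) ∨ ∀ᶠ u in 𝓝[<] t, u ∉ S
  -- No isolated points: this is the trace of the non-degeneracy of the intervals.
  adj : ∀ t ∈ S, (∀ᶠ u in 𝓝[>] t, u ∈ S) ∨ ∀ᶠ u in 𝓝[<] t, u ∈ S

lemma Tame.empty : Tame ∅ := by
  constructor <;> simp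

lemma Tame.union {S T : Set ℝ} (hS : Tame S) (hT : Tame T) : Tame (S ∪ T) := by
  refine ⟨hS.isCompact.union hT.isCompact, fun t => ?_, fun t => ?_, fun t ht => ?_⟩
  · rcases hS.right t with h | h
    · exact .inl (h.mono fun _ => .inl)
    rcases hT.right t with h' | h'
    · exact .inl (h'.mono fun _ => .inr)
    · exact .inr ((h.and h').mono fun _ hu => not_or.2 hu)
  · rcases hS.left t with h | h
    · exact .inl (h.mono fun _ => .inl)
    rcases hT.left t with h' | h'
    · exact .inl (h'.mono fun _ => .inr)
    · exact .inr ((h.and h').mono fun _ hu => not_or.2 hu)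
  · rcases ht with ht | ht
    · exact (hS.adj t ht).imp (fun h => h.mono fun _ => .inl) (fun h => h.mono fun _ => .inl)
    · exact (hT.adj t ht).imp (fun h => h.mono fun _ => .inr) (fun h => h.mono fun _ => .inr)

lemma Tame.Icc {a b : ℝ} (hab : a < b) : Tame (Icc a b) := by
  have key : ∀ c t : ℝ, c ≤ t → ∀ᶠ u in 𝓝[>] t, c < u := fun c t h =>
    eventually_mem_nhdsWithin.mono fun u hu => lt_of_le_of_lt h hu
  have key' : ∀ c t : ℝ, t < c → ∀ᶠ u in 𝓝[>] t, u < c := fun c t h =>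
    nhdsWithin_le_nhds (Iio_mem_nhds h)
  have key2 : ∀ c t : ℝ, t ≤ c → ∀ᶠ u in 𝓝[<] t, u < c := fun c t h =>
    eventually_mem_nhdsWithin.mono fun u hu => lt_of_lt_of_le hu h
  have key2' : ∀ c t : ℝ, c < t → ∀ᶠ u in 𝓝[<] t, c < u := fun c t h =>
    nhdsWithin_le_nhds (Ioi_mem_nhds h)
  refine ⟨isCompact_Icc, fun t => ?_, fun t => ?_, fun t ht => ?_⟩
  · rcases lt_or_ge t a with h | h
    · exact .inr ((key' a t h).mono fun u hu hu' => absurd hu'.1 hu.not_ge)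
    rcases lt_or_ge t b with h' | h'
    · exact .inl (((key a t h).and (key' b t h')).mono fun u hu => ⟨hu.1.le, hu.2.le⟩)
    · exact .inr ((key b t h').mono fun u hu hu' => absurd hu'.2 hu.not_ge)
  · rcases lt_or_ge b t with h | h
    · exact .inr ((key2' b t h).mono fun u hu hu' => absurd hu'.2 hu.not_ge)
    rcases lt_or_ge a t with h' | h'
    · exact .inl (((key2' a t h').and (key2 b t h)).mono fun u hu => ⟨hu.1.le, hu.2.le⟩)
    · exact .inr ((key2 a t h').mono fun u hu hu' => absurd hu'.1 hu.not_ge)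
  · rcases lt_or_ge t b with h' | h'
    · exact .inl (((key a t ht.1).and (key' b t h')).mono fun u hu => ⟨hu.1.le, hu.2.le⟩)
    · exact .inr (((key2' a t (hab.trans_le h')).and (key2 b t ht.2)).mono
        fun u hu => ⟨hu.1.le, hu.2.le⟩)

lemma Tame.biUnion {ι : Type*} (F : Finset ι) (S : ι → Set ℝ) (h : ∀ i ∈ F, Tame (S i)) :
    Tame (⋃ i ∈ F, S i) := by
  classical
  induction F using Finset.induction_on with
  | empty => simpa using Tame.empty
  | insert i F _ ih =>
    rw [Finset.set_biUnion_insert]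
    exact (h i (Finset.mem_insert_self i F)).union
      (ih fun j hj => h j (Finset.mem_insert_of_mem hj))

lemma eventually_nhdsLT_neg {p : ℝ → Prop} {t : ℝ} :
    (∀ᶠ u in 𝓝[<] t, p (-u)) ↔ ∀ᶠ u in 𝓝[>] (-t), p u := by
  constructor
  · intro h
    have := (tendsto_neg_nhdsGT (a := -t))
    rw [neg_neg] at this
    simpa using this.eventually h
  · intro h
    exact (tendsto_neg_nhdsLT (a := t)).eventually h

lemma eventually_nhdsGT_neg {p : ℝ → Prop} {t : ℝ} :
    (∀ᶠ u in 𝓝[>] t, p (-u)) ↔ ∀ᶠ u in 𝓝[<] (-t), p u := by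
  have := eventually_nhdsLT_neg (p := fun u => p (-u)) (t := -t)
  simpa using this.symm

lemma Tame.neg {S : Set ℝ} (hS : Tame S) : Tame (-S) := by
  refine ⟨hS.isCompact.neg, fun t => ?_, fun t => ?_, fun t ht => ?_⟩
  · exact (hS.left (-t)).imp eventually_nhdsGT_neg.2
      (eventually_nhdsGT_neg (p := fun u => u ∉ S)).2
  · exact (hS.right (-t)).imp eventually_nhdsLT_neg.2
      (eventually_nhdsLT_neg (p := fun u => u ∉ S)).2
  · exact ((hS.adj (-t) ht).imp eventually_nhdsLT_neg.2 eventually_nhdsGT_neg.2).symm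

/-! ### Maximal intervals in a compact set -/

/-- `[a, b]` is a maximal interval contained in `K`. -/
def IsMaxIcc (K : Set ℝ) (a b : ℝ) : Prop :=
  Icc a b ⊆ K ∧ ∀ a' b', a' ≤ a → b ≤ b' → Icc a' b' ⊆ K → a' = a ∧ b' = b

/-- The maximal interval is the connected component of `a` in `K`, which is compact because the
closure of a connected subset of the closed set `K` is again connected and inside `K`. -/
lemma exists_isMaxIcc {K : Set ℝ} (hK : IsCompact K) {a b : ℝ} (hab : a ≤ b) (h : Icc a b ⊆ K) :
    ∃ a' b', a' ≤ a ∧ b ≤ b' ∧ IsMaxIcc K a' b' := by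
  set C := connectedComponentIn K a with hC
  have haK : a ∈ K := h ⟨le_rfl, hab⟩
  have haC : a ∈ C := mem_connectedComponentIn haK
  have hCK : C ⊆ K := connectedComponentIn_subset K a
  have hCc : IsPreconnected C := isPreconnected_connectedComponentIn
  have hCcl : IsClosed C := by
    refine isClosed_of_closure_subset ?_
    exact hCc.closure.subset_connectedComponentIn (subset_closure haC)
      (closure_minimal hCK hK.isClosed)
  have hcomp : IsCompact C := hK.of_isClosed_subset hCcl hCK
  have hI : C = Icc (sInf C) (sSup C) := eq_Icc_of_connected_compact ⟨⟨a, haC⟩, hCc⟩ hcomp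
  have hbC : b ∈ C :=
    (isPreconnected_Icc.subset_connectedComponentIn (left_mem_Icc.2 hab) h) (right_mem_Icc.2 hab)
  refine ⟨sInf C, sSup C, (hI ▸ haC : a ∈ Icc (sInf C) (sSup C)).1,
    (hI ▸ hbC : b ∈ Icc (sInf C) (sSup C)).2, hI ▸ hCK, fun a' b' ha' hb' hs => ?_⟩
  have haI : a ∈ Icc (sInf C) (sSup C) := hI ▸ haC
  have hsub : Icc a' b' ⊆ C := isPreconnected_Icc.subset_connectedComponentIn
    (⟨ha'.trans haI.1, haI.2.trans hb'⟩ : a ∈ Icc a' b') hs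
  have hle : a' ≤ b' := ha'.trans ((haI.1.trans haI.2).trans hb')
  rw [hI] at hsub
  exact ⟨le_antisymm ha' (hsub (left_mem_Icc.2 hle)).1,
    le_antisymm (hsub (right_mem_Icc.2 hle)).2 hb'⟩

lemma IsMaxIcc.neg {K : Set ℝ} {a b : ℝ} (h : IsMaxIcc (-K) a b) : IsMaxIcc K (-b) (-a) := by
  refine ⟨fun x hx => ?_, fun a' b' ha hb hs => ?_⟩
  · have := h.1 (show -x ∈ Icc a b from ⟨by linarith [hx.2], by linarith [hx.1]⟩)
    simpa using this
  · have := h.2 (-b') (-a') (by linarith) (by linarith) fun x hx => by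
      exact hs ⟨by linarith [hx.2], by linarith [hx.1]⟩
    exact ⟨by linarith [this.2], by linarith [this.1]⟩

/-- A maximal interval absorbs every interval in `K` that meets it. -/
lemma IsMaxIcc.mem_of_uIcc_subset {K : Set ℝ} {a b x y : ℝ} (h : IsMaxIcc K a b)
    (hx : x ∈ Icc a b) (hs : uIcc x y ⊆ K) : y ∈ Icc a b := by
  have := h.2 (min a y) (max b y) (min_le_left _ _) (le_max_left _ _) ?_
  · exact ⟨by rw [← this.1]; exact min_le_right _ _, by rw [← this.2]; exact le_max_right _ _⟩
  · intro u hu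
    by_cases hu' : u ∈ Icc a b
    · exact h.1 hu'
    -- Only `y` can have enlarged the interval, so a point of it outside `[a, b]` lies between `x`
    -- and `y`.
    · refine hs (mem_uIcc.2 ?_)
      have h1 := min_le_iff.1 hu.1
      have h2 := le_max_iff.1 hu.2
      rw [mem_Icc, not_and_or, not_le, not_le] at hu'
      grind

/-! ### Passages and hits on a line -/

/-- Between `a` and `b` there are `n` points outside `A`, pairwise separated by points of `B`. -/
def Passages (A B : Set ℝ) (a b : ℝ) (n : ℕ) : Prop :=
  ∃ E : Finset ℝ, E.card = n ∧ (∀ x ∈ E, x ∈ uIcc a b ∧ x ∉ A) ∧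
    ∀ x ∈ E, ∀ y ∈ E, x < y → ∃ u ∈ B, x < u ∧ u < y

/-- Separating points lie strictly between points of the segment, so `B` and `B'` need to be
compared on the open interval only. This matters because the traces of the interior are not
controlled at the ends of a stretch of agreement. -/
lemma Passages.congr {A B A' B' : Set ℝ} {a b : ℝ} {n : ℕ} (h : Passages A B a b n)
    (hA : ∀ x ∈ uIcc a b, x ∈ A' → x ∈ A) (hB : ∀ x ∈ uIoo a b, x ∈ B → x ∈ B') :
    Passages A' B' a b n := by
  obtain ⟨E, hE, h1, h2⟩ := h
  refine ⟨E, hE, fun x hx => ⟨(h1 x hx).1, fun h => (h1 x hx).2 (hA x (h1 x hx).1 h)⟩,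
    fun x hx y hy hxy => ?_⟩
  obtain ⟨u, hu, hxu, huy⟩ := h2 x hx y hy hxy
  exact ⟨u, hB u ⟨(h1 x hx).1.1.trans_lt hxu, huy.trans_le (h1 y hy).1.2⟩ hu, hxu, huy⟩

lemma Passages.mono {A B : Set ℝ} {a b a' b' : ℝ} {n : ℕ} (h : Passages A B a b n)
    (hs : uIcc a b ⊆ uIcc a' b') : Passages A B a' b' n := by
  obtain ⟨E, hE, h1, h2⟩ := h
  exact ⟨E, hE, fun x hx => ⟨hs (h1 x hx).1, (h1 x hx).2⟩, h2⟩

lemma Passages.of_le {A B : Set ℝ} {a b : ℝ} {n m : ℕ} (h : Passages A B a b n) (hm : m ≤ n) :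
    Passages A B a b m := by
  obtain ⟨E, rfl, h1, h2⟩ := h
  obtain ⟨E', hE', rfl⟩ := Finset.exists_subset_card_eq hm
  exact ⟨E', rfl, fun x hx => h1 x (hE' hx), fun x hx y hy => h2 x (hE' hx) y (hE' hy)⟩

lemma Passages.symm {A B : Set ℝ} {a b : ℝ} {n : ℕ} (h : Passages A B a b n) :
    Passages A B b a n :=
  h.mono (uIcc_comm a b).subset

/-- Moving an end of the segment inside `A` does not change the passages. -/
lemma Passages.move_left {A B : Set ℝ} {a a' b : ℝ} {n : ℕ} (h : Passages A B a b n)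
    (hs : uIcc a a' ⊆ A) : Passages A B a' b n := by
  obtain ⟨E, hE, h1, h2⟩ := h
  refine ⟨E, hE, fun x hx => ⟨?_, (h1 x hx).2⟩, h2⟩
  exact (uIcc_subset_uIcc_union_uIcc (h1 x hx).1).resolve_left fun h => (h1 x hx).2 (hs h)

lemma Passages.move_right {A B : Set ℝ} {a b b' : ℝ} {n : ℕ} (h : Passages A B a b n)
    (hs : uIcc b b' ⊆ A) : Passages A B a b' n :=
  (h.symm.move_left hs).symm

lemma not_passages_of_uIcc_subset {A B : Set ℝ} {a b : ℝ} {n : ℕ} (hs : uIcc a b ⊆ A)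
    (hn : 0 < n) : ¬ Passages A B a b n := by
  rintro ⟨E, rfl, h1, -⟩
  obtain ⟨x, hx⟩ := Finset.card_pos.1 hn
  exact (h1 x hx).2 (hs (h1 x hx).1)

lemma Passages.neg {A B : Set ℝ} {a b : ℝ} {n : ℕ} (h : Passages (-A) (-B) a b n) :
    Passages A B (-a) (-b) n := by
  classical
  obtain ⟨E, rfl, h1, h2⟩ := h
  refine ⟨E.image Neg.neg, Finset.card_image_of_injective _ neg_injective, ?_, ?_⟩
  · intro x hx
    obtain ⟨y, hy, rfl⟩ := Finset.mem_image.1 hx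
    refine ⟨?_, (h1 y hy).2⟩
    have := mem_uIcc.1 (h1 y hy).1
    rw [mem_uIcc]
    rcases this with h | h
    · exact .inr ⟨neg_le_neg h.2, neg_le_neg h.1⟩
    · exact .inl ⟨neg_le_neg h.2, neg_le_neg h.1⟩
  · intro x hx y hy hxy
    obtain ⟨v, hv, rfl⟩ := Finset.mem_image.1 hx
    obtain ⟨w, hw, rfl⟩ := Finset.mem_image.1 hy
    obtain ⟨u, hu, h3, h4⟩ := h2 w hw v hv (neg_lt_neg_iff.1 hxy)
    exact ⟨-u, hu, neg_lt_neg h4, neg_lt_neg h3⟩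

/-- Moving upwards, one leaves `B` at the point `t` of `A`. -/
def HitsUp (A B : Set ℝ) (t : ℝ) : Prop := (t ∈ A ∧ t ∉ B) ∧ ∃ a < t, ∀ u ∈ Ioo a t, u ∈ B

/-- Moving downwards, one leaves `B` at the point `t` of `A`. -/
def HitsDown (A B : Set ℝ) (t : ℝ) : Prop := (t ∈ A ∧ t ∉ B) ∧ ∃ b > t, ∀ u ∈ Ioo t b, u ∈ B

/-- The reflection `t ↦ -t` exchanges the two directions; the downward statements are obtained from
the upward ones in this way. -/
lemma hitsUp_neg {A B : Set ℝ} {t : ℝ} : HitsUp (-A) (-B) t ↔ HitsDown A B (-t) := by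
  refine and_congr Iff.rfl ⟨?_, ?_⟩
  · rintro ⟨a, ha, h⟩
    refine ⟨-a, neg_lt_neg ha, fun u hu => ?_⟩
    have := h (-u) ⟨by linarith [hu.2], by linarith [hu.1]⟩
    simpa using this
  · rintro ⟨b, hb, h⟩
    exact ⟨-b, by linarith, fun u hu => h (-u) ⟨by linarith [hu.2], by linarith [hu.1]⟩⟩

/-- The part of `B` that starts at `x` ends at a hit. -/
lemma exists_hitsUp {A B : Set ℝ} (hA : IsClosed A) (hB : IsOpen B) (hBA : B ⊆ A) {x y : ℝ}
    (hx : x ∈ B) (hy : y ∉ B) (hxy : x ≤ y) :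
    ∃ h, x < h ∧ h ≤ y ∧ HitsUp A B h ∧ Ico x h ⊆ B := by
  -- The hit is the first point from `x` on that is outside `B`.
  set N := {u | x ≤ u ∧ u ∉ B} with hN
  have hcl : IsClosed N := (isClosed_Ici (a := x)).inter hB.isClosed_compl
  have hbd : BddBelow N := ⟨x, fun u hu => hu.1⟩
  have hmem : sInf N ∈ N := hcl.csInf_mem ⟨y, hxy, hy⟩ hbd
  have hlt : x < sInf N := lt_of_le_of_ne hmem.1 fun h => hmem.2 (h ▸ hx)
  have hIco : Ico x (sInf N) ⊆ B := fun u hu => by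
    by_contra hu'
    exact absurd (csInf_le hbd (show u ∈ N from ⟨hu.1, hu'⟩)) hu.2.not_ge
  refine ⟨sInf N, hlt, csInf_le hbd ⟨hxy, hy⟩, ⟨⟨?_, hmem.2⟩, x, hlt, fun u hu =>
    hIco ⟨hu.1.le, hu.2⟩⟩, hIco⟩
  have : closure (Ico x (sInf N)) ⊆ A := closure_minimal (hIco.trans hBA) hA
  rw [closure_Ico hlt.ne] at this
  exact this ⟨hlt.le, le_rfl⟩

/-- Hits after which one is outside `A` are passages. -/
lemma passages_of_hitsUp {A B : Set ℝ} {a b : ℝ} (H : Finset ℝ)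
    (h : ∀ u ∈ H, a ≤ u ∧ u < b ∧ HitsUp A B u ∧ ∀ᶠ v in 𝓝[>] u, v ∉ A) :
    Passages A B a b H.card := by
  classical
  -- `e u` is chosen so close after the hit `u` that all of `(u, e u]` avoids `A`. The next hit `w`
  -- is in `A`, hence `e u < w`, and the stretch of `B` that ends at `w` separates `e u` from `e w`.
  have hex : ∀ u, ∃ e, u ∈ H → u < e ∧ e < b ∧ ∀ v ∈ Ioc u e, v ∉ A := by
    intro u
    by_cases hu : u ∈ H
    · obtain ⟨-, h2, -, h4⟩ := h u hu
      obtain ⟨c, hc, hs⟩ := mem_nhdsGT_iff_exists_Ioo_subset.1 h4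
      have hc' : u < min c b := lt_min hc h2
      refine ⟨(u + min c b) / 2, fun _ => ⟨by linarith, ?_, fun v hv => hs ⟨hv.1, ?_⟩⟩⟩
      · linarith [min_le_right c b]
      · linarith [min_le_left c b, hv.2]
    · exact ⟨0, fun h => absurd h hu⟩
  choose e he using hex
  have hlt : ∀ u ∈ H, ∀ w ∈ H, u < w → e u < w := fun u hu w hw huw => by
    by_contra hcon
    exact (he u hu).2.2 w ⟨huw, not_lt.1 hcon⟩ (h w hw).2.2.1.1.1
  have hmono : ∀ u ∈ H, ∀ w ∈ H, u < w → e u < e w := fun u hu w hw huw =>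
    (hlt u hu w hw huw).trans (he w hw).1
  have hinj : Set.InjOn e H := fun u hu w hw huw => by
    rcases lt_trichotomy u w with h' | h' | h'
    · exact absurd huw (hmono u hu w hw h').ne
    · exact h'
    · exact absurd huw (hmono w hw u hu h').ne'
  refine ⟨H.image e, Finset.card_image_of_injOn hinj, ?_, ?_⟩
  · intro x hx
    obtain ⟨u, hu, rfl⟩ := Finset.mem_image.1 hx
    have h1 := h u hu
    have h2 := he u hu
    exact ⟨mem_uIcc.2 (.inl ⟨h1.1.trans h2.1.le, h2.2.1.le⟩), h2.2.2 _ ⟨h2.1, le_rfl⟩⟩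
  · intro x hx y hy hxy
    obtain ⟨u, hu, rfl⟩ := Finset.mem_image.1 hx
    obtain ⟨w, hw, rfl⟩ := Finset.mem_image.1 hy
    have huw : u < w := by
      rcases lt_trichotomy u w with h' | h' | h'
      · exact h'
      · exact absurd hxy (by rw [h']; exact lt_irrefl _)
      · exact absurd hxy (hmono w hw u hu h').not_gt
    obtain ⟨c, hc, hs⟩ := (h w hw).2.2.1.2
    have h3 : max c (e u) < w := max_lt hc (hlt u hu w hw huw)
    refine ⟨(max c (e u) + w) / 2, hs _ ⟨?_, ?_⟩, ?_, ?_⟩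
    · linarith [le_max_left c (e u)]
    · linarith
    · linarith [le_max_right c (e u)]
    · linarith [(he w hw).1]

/-- Every passage is preceded by its own hit. -/
lemma Passages.le_encard_hitsUp {A B : Set ℝ} (hA : IsClosed A) (hB : IsOpen B) (hBA : B ⊆ A)
    {a b : ℝ} {n : ℕ} (ha : a ∈ B) (hab : a ≤ b) (h : Passages A B a b n) :
    (n : ℕ∞) ≤ {u | a < u ∧ u < b ∧ HitsUp A B u}.encard := by
  classical
  obtain ⟨E, rfl, h1, h2⟩ := h
  rw [uIcc_of_le hab] at h1
  -- Before each `x ∈ E` there is a point of `B` after all earlier elements of `E`: the separator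
  -- from the largest of these, or `a` if there are none. The first exit from `B` after it is the
  -- hit assigned to `x`.
  have hsep : ∀ x ∈ E, ∃ u ∈ B, a ≤ u ∧ u < x ∧ ∀ y ∈ E, y < x → y < u := by
    intro x hx
    by_cases hne : (E.filter (· < x)).Nonempty
    · have hm := Finset.mem_filter.1 ((E.filter (· < x)).max'_mem hne)
      obtain ⟨u, hu, hu1, hu2⟩ := h2 _ hm.1 x hx hm.2
      exact ⟨u, hu, (h1 _ hm.1).1.1.trans hu1.le, hu2, fun y hy hyx =>
        (Finset.le_max' _ y (Finset.mem_filter.2 ⟨hy, hyx⟩)).trans_lt hu1⟩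
    · refine ⟨a, ha, le_rfl, lt_of_le_of_ne (h1 x hx).1.1 ?_, fun y hy hyx => ?_⟩
      · rintro rfl
        exact (h1 _ hx).2 (hBA ha)
      · exact absurd ⟨y, Finset.mem_filter.2 ⟨hy, hyx⟩⟩ hne
  have hex : ∀ x, ∃ t, x ∈ E → a < t ∧ t < x ∧ HitsUp A B t ∧ ∀ y ∈ E, y < x → y < t := by
    intro x
    by_cases hx : x ∈ E
    · obtain ⟨u, hu, hau, hux, hy⟩ := hsep x hx
      obtain ⟨t, ht1, ht2, ht3, -⟩ :=
        exists_hitsUp hA hB hBA hu (fun h => (h1 x hx).2 (hBA h)) hux.le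
      refine ⟨t, fun _ => ⟨hau.trans_lt ht1, lt_of_le_of_ne ht2 ?_, ht3,
        fun y hyE hyx => (hy y hyE hyx).trans ht1⟩⟩
      rintro rfl
      exact (h1 _ hx).2 ht3.1.1
    · exact ⟨0, fun h => absurd h hx⟩
  choose f hf using hex
  have hmono : ∀ x ∈ E, ∀ y ∈ E, x < y → f x < f y := fun x hx y hy hxy =>
    (hf x hx).2.1.trans ((hf y hy).2.2.2 x hx hxy)
  have hinj : Set.InjOn f E := fun u hu w hw huw => by
    rcases lt_trichotomy u w with h' | h' | h'
    · exact absurd huw (hmono u hu w hw h').ne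
    · exact h'
    · exact absurd huw (hmono w hw u hu h').ne'
  rw [← Finset.card_image_of_injOn hinj, ← Set.encard_coe_eq_coe_finsetCard]
  refine Set.encard_le_encard fun t ht => ?_
  obtain ⟨x, hx, rfl⟩ := Finset.mem_image.1 (Finset.mem_coe.1 ht)
  exact ⟨(hf x hx).1, (hf x hx).2.1.trans_le (h1 x hx).1.2, (hf x hx).2.2.1⟩

lemma exists_finset_of_le_encard {S : Set ℝ} {n : ℕ} (h : (n : ℕ∞) ≤ S.encard) :
    ∃ H : Finset ℝ, ↑H ⊆ S ∧ H.card = n := by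
  obtain ⟨T, hT, hn⟩ := exists_subset_encard_eq h
  have hfin : T.Finite := Set.finite_of_encard_eq_coe hn
  refine ⟨hfin.toFinset, by simpa using hT, ?_⟩
  have := hfin.encard_eq_coe_toFinset_card
  rw [hn] at this
  exact_mod_cast this.symm

/-! ### A line seen from its two sides

`U` and `L` are the traces of the polygon on the parallels just above and just below a line. Then
`U ∪ L` is its trace on the line, and `interior U ∩ interior L` that of its interior. -/

section TwoSides

variable {U L : Set ℝ}

/-- The trace of the boundary. -/
def bdry (U L : Set ℝ) : Set ℝ := (U ∪ L) \ (interior U ∩ interior L)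

/-- The two sides of the line coincide between `a` and `b`. -/
def Agree (U L : Set ℝ) (a b : ℝ) : Prop := ∀ x ∈ uIcc a b, x ∈ U ↔ x ∈ L

lemma inner_subset : interior U ∩ interior L ⊆ U ∪ L := fun _ h => .inl (interior_subset h.1)

lemma isOpen_inner : IsOpen (interior U ∩ interior L) := isOpen_interior.inter isOpen_interior

lemma isCompact_bdry (hU : Tame U) (hL : Tame L) : IsCompact (bdry U L) :=
  (hU.isCompact.union hL.isCompact).diff isOpen_inner

lemma bdry_neg : bdry (-U) (-L) = -bdry U L := by
  have h : ∀ S : Set ℝ, interior (-S) = -interior S := fun S =>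
    ((Homeomorph.neg ℝ).preimage_interior S).symm
  simp only [bdry, h]
  rfl

lemma inner_neg : interior (-U) ∩ interior (-L) = -(interior U ∩ interior L) := by
  have h : ∀ S : Set ℝ, interior (-S) = -interior S := fun S =>
    ((Homeomorph.neg ℝ).preimage_interior S).symm
  simp only [h]
  rfl

lemma mem_interior_of_germs {S : Set ℝ} {t : ℝ} (hS : IsClosed S) (hl : ∀ᶠ u in 𝓝[<] t, u ∈ S)
    (hr : ∀ᶠ u in 𝓝[>] t, u ∈ S) : t ∈ interior S := by
  have ht : t ∈ S := hS.mem_of_frequently_of_tendsto hr.frequently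
    (tendsto_id.mono_left nhdsWithin_le_nhds)
  rw [mem_interior_iff_mem_nhds, ← nhdsNE_sup_pure, ← nhdsLT_sup_nhdsGT]
  exact ⟨⟨hl, hr⟩, ht⟩

/-- Along a stretch where the two sides coincide one leaves the interior only to the exterior. -/
lemma eventually_notMem_of_hitsUp (hU : Tame U) (hL : Tame L) {t : ℝ}
    (hst : ∀ᶠ u in 𝓝[>] t, u ∈ U ↔ u ∈ L) (h : HitsUp (U ∪ L) (interior U ∩ interior L) t) :
    ∀ᶠ v in 𝓝[>] t, v ∉ U ∪ L := by
  obtain ⟨⟨-, h2⟩, c, hc, hs⟩ := h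
  have hleft : ∀ᶠ u in 𝓝[<] t, u ∈ interior U ∩ interior L :=
    mem_nhdsLT_iff_exists_Ioo_subset.2 ⟨c, hc, hs⟩
  rcases hU.right t with hr | hr
  · refine absurd ⟨?_, ?_⟩ h2
    · exact mem_interior_of_germs hU.isCompact.isClosed
        (hleft.mono fun u hu => interior_subset hu.1) hr
    · exact mem_interior_of_germs hL.isCompact.isClosed
        (hleft.mono fun u hu => interior_subset hu.2) (by
          filter_upwards [hr, hst] with u h3 h4 using h4.1 h3)
  · filter_upwards [hr, hst] with u h3 h4
    rintro (h | h)
    exacts [h3 h, h3 (h4.2 h)]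

lemma Agree.neg {a b : ℝ} (h : Agree U L a b) : Agree (-U) (-L) (-a) (-b) := fun x hx => by
  refine h (-x) ?_
  rw [mem_uIcc] at hx ⊢
  rcases hx with hx | hx
  · exact .inr ⟨by linarith [hx.2], by linarith [hx.1]⟩
  · exact .inl ⟨by linarith [hx.2], by linarith [hx.1]⟩

lemma Agree.neg' {a b : ℝ} (h : Agree (-U) (-L) a b) : Agree U L (-a) (-b) := by
  simpa using h.neg

/-- Near every point, the line to the left runs along the boundary where the two sides differ, or
avoids the boundary. -/
lemma bdry_left_germ (hU : Tame U) (hL : Tame L) (t : ℝ) : ∃ l < t,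
    (∀ x ∈ Ioo l t, x ∈ bdry U L ∧ ¬ (x ∈ U ↔ x ∈ L)) ∨ ∀ x ∈ Ioo l t, x ∉ bdry U L := by
  have aux : ∀ S : Set ℝ, Tame S → ∃ l < t, (Ioo l t ⊆ S) ∨ (Ioo l t ⊆ Sᶜ) := by
    intro S hS
    rcases hS.left t with h | h
    · obtain ⟨l, hl, hs⟩ := mem_nhdsLT_iff_exists_Ioo_subset.1 h
      exact ⟨l, hl, .inl hs⟩
    · obtain ⟨l, hl, hs⟩ := mem_nhdsLT_iff_exists_Ioo_subset.1 h
      exact ⟨l, hl, .inr hs⟩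
  obtain ⟨l₁, hl₁, h₁⟩ := aux U hU
  obtain ⟨l₂, hl₂, h₂⟩ := aux L hL
  have e₁ : Ioo (max l₁ l₂) t ⊆ Ioo l₁ t := Ioo_subset_Ioo_left (le_max_left _ _)
  have e₂ : Ioo (max l₁ l₂) t ⊆ Ioo l₂ t := Ioo_subset_Ioo_left (le_max_right _ _)
  refine ⟨max l₁ l₂, max_lt hl₁ hl₂, ?_⟩
  rcases h₁ with h₁ | h₁ <;> rcases h₂ with h₂ | h₂
  · refine .inr fun x hx hb => hb.2 ⟨?_, ?_⟩
    · exact interior_maximal h₁ isOpen_Ioo (e₁ hx)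
    · exact interior_maximal h₂ isOpen_Ioo (e₂ hx)
  · refine .inl fun x hx => ⟨⟨.inl (h₁ (e₁ hx)), fun hb => ?_⟩, fun h => ?_⟩
    · exact h₂ (e₂ hx) (interior_subset hb.2)
    · exact h₂ (e₂ hx) (h.1 (h₁ (e₁ hx)))
  · refine .inl fun x hx => ⟨⟨.inr (h₂ (e₂ hx)), fun hb => ?_⟩, fun h => ?_⟩
    · exact h₁ (e₁ hx) (interior_subset hb.1)
    · exact h₁ (e₁ hx) (h.2 (h₂ (e₂ hx)))
  · exact .inr fun x hx hb => hb.1.elim (h₁ (e₁ hx)) (h₂ (e₂ hx))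

/-- A segment of the boundary contains points where the two sides differ. -/
lemma exists_disagree_of_Icc_subset_bdry (hU : Tame U) (hL : Tame L) {a b : ℝ} (hab : a < b)
    (h : Icc a b ⊆ bdry U L) : ∃ x, ¬ (x ∈ U ↔ x ∈ L) := by
  obtain ⟨l, hl, hg⟩ := bdry_left_germ hU hL b
  obtain ⟨x, hx1, hx2⟩ := exists_between (max_lt hl hab)
  have hx : x ∈ Ioo l b := ⟨(le_max_left _ _).trans_lt hx1, hx2⟩
  rcases hg with hg | hg
  · exact ⟨x, (hg x hx).2⟩
  · exact absurd (h ⟨(le_max_right _ _).trans hx1.le, hx2.le⟩) (hg x hx)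

/-- Since `L` is closed, it avoids a neighbourhood of `x`, while `Tame.adj` gives a one-sided
stretch of `U` at `x`. This is a non-degenerate piece of boundary. Hence sides can differ only where
the line carries an edge. -/
lemma exists_isMaxIcc_bdry_of_mem_of_notMem (hU : Tame U) (hL : Tame L) {x : ℝ} (hxU : x ∈ U)
    (hxL : x ∉ L) : ∃ lo hi, lo < hi ∧ x ∈ Icc lo hi ∧ IsMaxIcc (bdry U L) lo hi := by
  have hnL : ∀ᶠ u in 𝓝 x, u ∉ L := hL.isCompact.isClosed.isOpen_compl.mem_nhds hxL
  have hb : ∀ u, u ∈ U → u ∉ L → u ∈ bdry U L := fun u h1 h2 =>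
    ⟨.inl h1, fun h => h2 (interior_subset h.2)⟩
  have hex : ∃ a b, a < b ∧ x ∈ Icc a b ∧ Icc a b ⊆ bdry U L := by
    rcases hU.adj x hxU with h | h
    · obtain ⟨c, hc, hs⟩ := mem_nhdsGT_iff_exists_Ioo_subset.1
        (h.and (hnL.filter_mono nhdsWithin_le_nhds))
      have hc' : x < c := hc
      refine ⟨x, (x + c) / 2, by linarith, ⟨le_rfl, by linarith⟩, fun u hu => ?_⟩
      rcases hu.1.eq_or_lt with rfl | hlt
      · exact hb _ hxU hxL
      · have := hs ⟨hlt, by linarith [hu.2]⟩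
        exact hb _ this.1 this.2
    · obtain ⟨c, hc, hs⟩ := mem_nhdsLT_iff_exists_Ioo_subset.1
        (h.and (hnL.filter_mono nhdsWithin_le_nhds))
      have hc' : c < x := hc
      refine ⟨(c + x) / 2, x, by linarith, ⟨by linarith, le_rfl⟩, fun u hu => ?_⟩
      rcases hu.2.eq_or_lt with rfl | hlt
      · exact hb _ hxU hxL
      · have := hs ⟨by linarith [hu.1], hlt⟩
        exact hb _ this.1 this.2
  obtain ⟨a, b, hab, hx, hs⟩ := hex
  obtain ⟨a', b', ha, hb', hm⟩ := exists_isMaxIcc (isCompact_bdry hU hL) hab.le hs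
  exact ⟨a', b', by linarith, ⟨ha.trans hx.1, hx.2.trans hb'⟩, hm⟩

lemma exists_isMaxIcc_bdry_of_disagree (hU : Tame U) (hL : Tame L) {x : ℝ}
    (hx : ¬ (x ∈ U ↔ x ∈ L)) : ∃ lo hi, lo < hi ∧ x ∈ Icc lo hi ∧ IsMaxIcc (bdry U L) lo hi := by
  by_cases hxU : x ∈ U
  · exact exists_isMaxIcc_bdry_of_mem_of_notMem hU hL hxU fun h => hx ⟨fun _ => h, fun _ => hxU⟩
  · have hxL : x ∈ L := by
      by_contra h
      exact hx ⟨fun h' => absurd h' hxU, fun h' => absurd h' h⟩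
    have := exists_isMaxIcc_bdry_of_mem_of_notMem hL hU hxL hxU
    rwa [bdry, union_comm, inter_comm, ← bdry] at this

/-- If every edge to the left of `z` on the line is too far away for its extension to reach `z`,
then one has to pass the exterior `n` times before reaching a point where the two sides differ. -/
lemma exists_passages_of_disagree_left (hU : Tame U) (hL : Tame L) {z x : ℝ} {n : ℕ} (hn : 0 < n)
    (hz : z ∈ interior U ∩ interior L) (hxz : x ≤ z) (hx : ¬ (x ∈ U ↔ x ∈ L))
    (hedge : ∀ lo hi, lo < hi → hi < z → IsMaxIcc (bdry U L) lo hi →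
      (n : ℕ∞) ≤ {u | hi < u ∧ u < z ∧ HitsUp (U ∪ L) (interior U ∩ interior L) u}.encard) :
    ∃ t ∈ uIcc z x, Agree U L z t ∧ Passages (U ∪ L) (interior U ∩ interior L) z t n := by
  -- The upper ends of the edges to the left of `z`; the relevant edge is the one with the largest
  -- upper end.
  set M := {hi | ∃ lo < hi, hi < z ∧ IsMaxIcc (bdry U L) lo hi} with hM
  have hdis : ∀ y ≤ z, ¬ (y ∈ U ↔ y ∈ L) → ∃ hi ∈ M, y ≤ hi := by
    intro y hyz hy
    obtain ⟨lo, hi, hlt, hym, hmax⟩ := exists_isMaxIcc_bdry_of_disagree hU hL hy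
    refine ⟨hi, ⟨lo, hlt, ?_, hmax⟩, hym.2⟩
    by_contra hcon
    exact (hmax.1 ⟨hym.1.trans hyz, not_lt.1 hcon⟩).2 hz
  have hbdd : BddAbove M := ⟨z, fun hi ⟨_, _, h, _⟩ => h.le⟩
  obtain ⟨hi₀, hhi₀, hxhi⟩ := hdis x hxz hx
  -- If the supremum were not attained, edges would end arbitrarily closely below it. But just below
  -- it the line either runs along the boundary, so that such an edge could be prolonged, or avoids
  -- the boundary.
  have hTM : sSup M ∈ M := by
    by_contra hcon
    obtain ⟨l, hl, hg⟩ := bdry_left_germ hU hL (sSup M)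
    obtain ⟨hi, hhi, hlhi⟩ := exists_lt_of_lt_csSup ⟨hi₀, hhi₀⟩ hl
    have hlt : hi < sSup M := lt_of_le_of_ne (le_csSup hbdd hhi) fun h => hcon (h ▸ hhi)
    obtain ⟨lo, hlo, -, hmax⟩ := hhi
    rcases hg with hg | hg
    · have := hmax.2 lo ((hi + sSup M) / 2) le_rfl (by linarith) fun u hu => by
        rcases le_or_gt u hi with h | h
        · exact hmax.1 ⟨hu.1, h⟩
        · exact (hg u ⟨hlhi.trans h, by linarith [hu.2]⟩).1
      linarith [this.2]
    · exact hg hi ⟨hlhi, hlt⟩ (hmax.1 ⟨hlo.le, le_rfl⟩)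
  have hag : ∀ y, sSup M < y → y ≤ z → (y ∈ U ↔ y ∈ L) := by
    intro y hy hyz
    by_contra hcon
    obtain ⟨hi, hhi, hle⟩ := hdis y hyz hcon
    exact absurd (le_csSup hbdd hhi) (hy.trans_le hle).not_ge
  obtain ⟨lo, hlo, hTz, hmax⟩ := hTM
  obtain ⟨H, hH, rfl⟩ := exists_finset_of_le_encard (hedge lo _ hlo hTz hmax)
  have hne : H.Nonempty := Finset.card_pos.1 hn
  obtain ⟨hm1, hm2, -⟩ := hH (H.min'_mem hne)
  -- The target is the lowest of `n` hits after the last edge. From there up to `z` the sides agree,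
  -- so each of the hits is a passage.
  refine ⟨H.min' hne, mem_uIcc.2 (.inr ⟨?_, hm2.le⟩), ?_, ?_⟩
  · exact hxhi.trans ((le_csSup hbdd hhi₀).trans hm1.le)
  · intro y hy
    rw [uIcc_of_ge hm2.le] at hy
    exact hag y (hm1.trans_le hy.1) hy.2
  · refine Passages.symm (passages_of_hitsUp H fun u hu => ?_)
    obtain ⟨h1, h2, h3⟩ := hH hu
    refine ⟨H.min'_le u hu, h2, h3, eventually_notMem_of_hitsUp hU hL ?_ h3⟩
    filter_upwards [Ioo_mem_nhdsGT h2] with v hv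
    exact hag v (h1.trans hv.1) hv.2.le

lemma exists_passages_of_disagree_right (hU : Tame U) (hL : Tame L) {z x : ℝ} {n : ℕ} (hn : 0 < n)
    (hz : z ∈ interior U ∩ interior L) (hxz : z ≤ x) (hx : ¬ (x ∈ U ↔ x ∈ L))
    (hedge : ∀ lo hi, lo < hi → z < lo → IsMaxIcc (bdry U L) lo hi →
      (n : ℕ∞) ≤ {u | z < u ∧ u < lo ∧ HitsDown (U ∪ L) (interior U ∩ interior L) u}.encard) :
    ∃ t ∈ uIcc z x, Agree U L z t ∧ Passages (U ∪ L) (interior U ∩ interior L) z t n := by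
  obtain ⟨t, ht, hag, hp⟩ := exists_passages_of_disagree_left hU.neg hL.neg (z := -z) (x := -x) hn
    (by rw [inner_neg]; simpa using hz) (neg_le_neg hxz) (by simpa using hx) (by
      intro lo hi hlt hiz hmax
      rw [bdry_neg] at hmax
      refine (hedge (-hi) (-lo) (neg_lt_neg hlt) (by linarith) hmax.neg).trans ?_
      rw [← (neg_injective (G := ℝ)).encard_image]
      refine Set.encard_le_encard ?_
      rintro _ ⟨u, ⟨h1, h2, h3⟩, rfl⟩
      refine ⟨by linarith, by linarith, ?_⟩
      rw [inner_neg, ← union_neg, hitsUp_neg, neg_neg]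
      exact h3)
  refine ⟨-t, ?_, by simpa using hag.neg', ?_⟩
  · rw [mem_uIcc] at ht ⊢
    rcases ht with h | h
    · exact .inr ⟨by linarith [h.2], by linarith [h.1]⟩
    · exact .inl ⟨by linarith [h.2], by linarith [h.1]⟩
  · rw [inner_neg, ← union_neg] at hp
    simpa using hp.neg

/-- A point of the line beyond `c` that is seen from `z` is covered by the extension. -/
lemma exists_hitsUp_of_not_passages (hU : Tame U) (hL : Tame L) {z c t : ℝ} {n : ℕ} (hzc : z ≤ c)
    (hct : c < t) (ht : t ∈ U ∪ L) (hag : Agree U L z t)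
    (hp : ¬ Passages (U ∪ L) (interior U ∩ interior L) z t n) :
    ∃ b, c < b ∧ t ≤ b ∧ HitsUp (U ∪ L) (interior U ∩ interior L) b ∧
      {u | c < u ∧ u < b ∧ HitsUp (U ∪ L) (interior U ∩ interior L) u}.encard < n := by
  have hzt : z < t := hzc.trans_lt hct
  have hUL : t ∈ U ∧ t ∈ L := by
    have := hag t right_mem_uIcc
    rcases ht with h | h
    exacts [⟨h, this.1 h⟩, ⟨this.2 h, h⟩]
  have hcl : IsClosed (U ∪ L) := (hU.isCompact.union hL.isCompact).isClosed
  have hfar : ∀ x, ∃ y, x ≤ y ∧ y ∉ interior U ∩ interior L := by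
    intro x
    obtain ⟨M, hM⟩ := hU.isCompact.bddAbove
    refine ⟨max x (M + 1), le_max_left _ _, fun h => ?_⟩
    have := hM (interior_subset h.1)
    linarith [le_max_right x (M + 1)]
  -- `b` is the first hit at or after `t`. If `t` is inner, it ends the inner stretch containing
  -- `t`. If the points just before `t` are in `P`, then `b = t`. Otherwise `Tame.adj` puts the
  -- points just after `t` on both sides, and `b` ends the inner stretch that starts at `t`.
  have hb : ∃ b, t ≤ b ∧ HitsUp (U ∪ L) (interior U ∩ interior L) b ∧
      ∀ u, u < b → HitsUp (U ∪ L) (interior U ∩ interior L) u → u < t := by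
    by_cases htB : t ∈ interior U ∩ interior L
    · obtain ⟨y, hty, hy⟩ := hfar t
      obtain ⟨b, h1, -, h3, h4⟩ := exists_hitsUp hcl isOpen_inner inner_subset htB hy hty
      exact ⟨b, h1.le, h3, fun u hu hh => not_le.1 fun h => hh.1.2 (h4 ⟨h, hu⟩)⟩
    have hst : ∀ᶠ u in 𝓝[<] t, u ∈ U ↔ u ∈ L := by
      filter_upwards [Ioo_mem_nhdsLT hzt] with u hu
      exact hag u (mem_uIcc.2 (.inl ⟨hu.1.le, hu.2.le⟩))
    rcases hU.left t with hl | hl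
    · have hl' : ∀ᶠ u in 𝓝[<] t, u ∈ L := by
        filter_upwards [hl, hst] with u h3 h4 using h4.1 h3
      obtain ⟨a, ha, hs⟩ := mem_nhdsLT_iff_exists_Ioo_subset.1 (hl.and hl')
      refine ⟨t, le_rfl, ⟨⟨ht, htB⟩, a, ha, fun u hu => ⟨?_, ?_⟩⟩, fun u hu _ => hu⟩
      · exact interior_maximal (fun v hv => (hs hv).1) isOpen_Ioo hu
      · exact interior_maximal (fun v hv => (hs hv).2) isOpen_Ioo hu
    · have hl' : ∀ᶠ u in 𝓝[<] t, u ∉ L := by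
        filter_upwards [hl, hst] with u h3 h4 using fun h => h3 (h4.2 h)
      have hr : ∀ᶠ u in 𝓝[>] t, u ∈ U := (hU.adj t hUL.1).resolve_right fun h => by
        obtain ⟨u, h1, h2⟩ := (hl.and h).exists
        exact h1 h2
      have hr' : ∀ᶠ u in 𝓝[>] t, u ∈ L := (hL.adj t hUL.2).resolve_right fun h => by
        obtain ⟨u, h1, h2⟩ := (hl'.and h).exists
        exact h1 h2
      obtain ⟨a, ha, hs⟩ := mem_nhdsGT_iff_exists_Ioo_subset.1 (hr.and hr')
      have hsB : Ioo t a ⊆ interior U ∩ interior L := fun u hu =>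
        ⟨interior_maximal (fun v hv => (hs hv).1) isOpen_Ioo hu,
          interior_maximal (fun v hv => (hs hv).2) isOpen_Ioo hu⟩
      obtain ⟨w, hw1, hw2⟩ := exists_between (show t < a from ha)
      obtain ⟨y, hwy, hy⟩ := hfar w
      obtain ⟨b, h1, -, h3, h4⟩ :=
        exists_hitsUp hcl isOpen_inner inner_subset (hsB ⟨hw1, hw2⟩) hy hwy
      refine ⟨b, (hw1.trans h1).le, h3, fun u hu hh => not_le.1 fun h => ?_⟩
      rcases h.eq_or_lt with rfl | h
      · obtain ⟨e, he, hse⟩ := hh.2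
        have : ∀ᶠ u in 𝓝[<] t, u ∈ Ioo e t := Ioo_mem_nhdsLT he
        obtain ⟨v, hv1, hv2⟩ := (this.and hl).exists
        exact hv2 (interior_subset (hse v hv1).1)
      · rcases lt_or_ge u w with h' | h'
        · exact hh.1.2 (hsB ⟨h, h'.trans hw2⟩)
        · exact hh.1.2 (h4 ⟨h', hu⟩)
  obtain ⟨b, htb, hbh, hlt⟩ := hb
  refine ⟨b, hct.trans_le htb, htb, hbh, ?_⟩
  -- Hits before `b` are before `t`, where the sides agree; so `n` of them would be `n` passages
  -- between `z` and `t`.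
  by_contra hcon
  obtain ⟨H, hH, rfl⟩ := exists_finset_of_le_encard (not_lt.1 hcon)
  refine hp (passages_of_hitsUp H fun u hu => ?_)
  obtain ⟨h1, h2, h3⟩ := hH hu
  have hut : u < t := hlt u h2 h3
  refine ⟨hzc.trans h1.le, hut, h3, eventually_notMem_of_hitsUp hU hL ?_ h3⟩
  filter_upwards [Ioo_mem_nhdsGT hut] with v hv
  exact hag v (mem_uIcc.2 (.inl ⟨hzc.trans (h1.trans hv.1).le, hv.2.le⟩))

lemma exists_hitsDown_of_not_passages (hU : Tame U) (hL : Tame L) {z c t : ℝ} {n : ℕ} (hzc : c ≤ z)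
    (hct : t < c) (ht : t ∈ U ∪ L) (hag : Agree U L z t)
    (hp : ¬ Passages (U ∪ L) (interior U ∩ interior L) z t n) :
    ∃ b, b < c ∧ b ≤ t ∧ HitsDown (U ∪ L) (interior U ∩ interior L) b ∧
      {u | b < u ∧ u < c ∧ HitsDown (U ∪ L) (interior U ∩ interior L) u}.encard < n := by
  obtain ⟨b, h1, h2, h3, h4⟩ := exists_hitsUp_of_not_passages hU.neg hL.neg (n := n)
    (neg_le_neg hzc) (neg_lt_neg hct) (by simpa using ht) hag.neg (by
      rw [inner_neg, ← union_neg]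
      intro h
      exact hp (by simpa using h.neg))
  rw [inner_neg, ← union_neg] at h3 h4
  refine ⟨-b, by linarith, by linarith, hitsUp_neg.1 h3, lt_of_le_of_lt ?_ h4⟩
  rw [← (neg_injective (G := ℝ)).encard_image]
  refine Set.encard_le_encard ?_
  rintro _ ⟨u, ⟨h1, h2, h3⟩, rfl⟩
  exact ⟨by linarith, by linarith, hitsUp_neg.2 (by simpa using h3)⟩

end TwoSides

lemma exists_hitsDown {A B : Set ℝ} (hA : IsClosed A) (hB : IsOpen B) (hBA : B ⊆ A) {x y : ℝ}
    (hx : x ∈ B) (hy : y ∉ B) (hxy : y ≤ x) :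
    ∃ h, h < x ∧ y ≤ h ∧ HitsDown A B h ∧ Ioc h x ⊆ B := by
  obtain ⟨h, h1, h2, h3, h4⟩ := exists_hitsUp hA.neg hB.neg (neg_subset_neg.2 hBA)
    (x := -x) (y := -y) (by simpa using hx) (by simpa using hy) (by linarith)
  refine ⟨-h, by linarith, by linarith, hitsUp_neg.1 h3, fun u hu => ?_⟩
  have := h4 (show -u ∈ Ico (-x) h from ⟨by linarith [hu.2], by linarith [hu.1]⟩)
  simpa using this

lemma Passages.le_encard_hitsDown {A B : Set ℝ} (hA : IsClosed A) (hB : IsOpen B) (hBA : B ⊆ A)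
    {a b : ℝ} {n : ℕ} (ha : a ∈ B) (hab : b ≤ a) (h : Passages A B a b n) :
    (n : ℕ∞) ≤ {u | b < u ∧ u < a ∧ HitsDown A B u}.encard := by
  have h' : Passages (-A) (-B) (-a) (-b) n :=
    Passages.neg (A := -A) (B := -B) (by simpa using h)
  refine (h'.le_encard_hitsUp hA.neg hB.neg (neg_subset_neg.2 hBA) (by simpa using ha)
    (by linarith)).trans ?_
  rw [← (neg_injective (G := ℝ)).encard_image]
  refine Set.encard_le_encard ?_
  rintro _ ⟨u, ⟨h1, h2, h3⟩, rfl⟩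
  exact ⟨by linarith, by linarith, hitsUp_neg.1 h3⟩

/-! ### Coordinates -/

@[simp] lemma Dir.perp_perp (d : Dir) : d.perp.perp = d := by cases d <;> rfl

@[simp] lemma coord_pt (d : Dir) (c t : ℝ) : coord d (pt d c t) = t := by cases d <;> rfl

@[simp] lemma coord_perp_pt (d : Dir) (c t : ℝ) : coord d.perp (pt d c t) = c := by
  cases d <;> rfl

@[simp] lemma pt_coord (d : Dir) (p : ℝ × ℝ) : pt d (coord d.perp p) (coord d p) = p := by
  cases d <;> rfl

lemma pt_perp (d : Dir) (c t : ℝ) : pt d.perp c t = pt d t c := by cases d <;> rfl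

lemma pt_inj {d : Dir} {c t c' t' : ℝ} : pt d c t = pt d c' t' ↔ c = c' ∧ t = t' := by
  cases d <;> simp [pt, and_comm]

lemma continuous_coord (d : Dir) : Continuous (coord d) := by
  cases d
  exacts [continuous_fst, continuous_snd]

lemma continuous_pt (d : Dir) : Continuous fun q : ℝ × ℝ => pt d q.1 q.2 := by
  cases d
  exacts [continuous_snd.prodMk continuous_fst, continuous_id]

lemma lineMap_pt (d : Dir) (c a b t : ℝ) :
    AffineMap.lineMap (pt d c a) (pt d c b) t = pt d c (AffineMap.lineMap a b t) := by
  cases d <;> simp [pt, AffineMap.lineMap_apply]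

lemma pt_mem_carrier {s : Seg} {c t : ℝ} :
    pt s.dir c t ∈ s.carrier ↔ c = s.level ∧ t ∈ Icc s.lo s.hi := by
  constructor
  · rintro ⟨u, hu, h⟩
    rw [pt_inj] at h
    exact ⟨h.1.symm, h.2 ▸ hu⟩
  · rintro ⟨rfl, ht⟩
    exact ⟨t, ht, rfl⟩

lemma eq_of_carrier_subset {e s : Seg} (h : e.carrier ⊆ s.carrier) :
    s.dir = e.dir ∧ s.level = e.level ∧ s.lo ≤ e.lo ∧ e.hi ≤ s.hi := by
  have hlo := h (mem_image_of_mem _ (left_mem_Icc.2 e.lo_lt_hi.le))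
  have hhi := h (mem_image_of_mem _ (right_mem_Icc.2 e.lo_lt_hi.le))
  have hdir : s.dir = e.dir := by
    by_contra hne
    have hp : e.dir = s.dir.perp := by
      revert hne
      cases s.dir <;> cases e.dir <;> simp [Dir.perp]
    rw [hp, pt_perp, pt_mem_carrier] at hlo hhi
    exact e.lo_lt_hi.ne (hlo.1.trans hhi.1.symm)
  rw [← hdir, pt_mem_carrier] at hlo hhi
  exact ⟨hdir, hlo.1.symm, hlo.2.1, hhi.2.2⟩

/-- The trace of a set on a line. -/
def line (K : Set (ℝ × ℝ)) (d : Dir) (c : ℝ) : Set ℝ := pt d c ⁻¹' K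

@[simp] lemma mem_line {K : Set (ℝ × ℝ)} {d : Dir} {c t : ℝ} : t ∈ line K d c ↔ pt d c t ∈ K :=
  Iff.rfl

lemma carrier_subset_iff {s : Seg} {K : Set (ℝ × ℝ)} :
    s.carrier ⊆ K ↔ Icc s.lo s.hi ⊆ line K s.dir s.level :=
  image_subset_iff

/-- The maximal segments in a set are the maximal intervals of its traces. -/
lemma maximal_carrier_iff {s : Seg} {K : Set (ℝ × ℝ)} :
    (s.carrier ⊆ K ∧ ∀ s' : Seg, s'.carrier ⊆ K → s.carrier ⊆ s'.carrier → s' = s) ↔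
      IsMaxIcc (line K s.dir s.level) s.lo s.hi := by
  refine and_congr carrier_subset_iff ⟨fun h a b ha hb hs => ?_, fun h s' hs' hss' => ?_⟩
  · have hab : a < b := ha.trans_lt (s.lo_lt_hi.trans_le hb)
    have := h ⟨s.dir, s.level, a, b, hab⟩ (carrier_subset_iff.2 hs)
      (image_mono (Icc_subset_Icc ha hb))
    rw [Seg.ext_iff] at this
    exact this.2.2
  · obtain ⟨h1, h2, h3, h4⟩ := eq_of_carrier_subset hss'
    rw [carrier_subset_iff, h1, h2] at hs'
    obtain ⟨h5, h6⟩ := h _ _ h3 h4 hs'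
    exact Seg.ext h1 h2 h5 h6

lemma isEdge_iff {P : Set (ℝ × ℝ)} {e : Seg} :
    IsEdge P e ↔ IsMaxIcc (line (frontier P) e.dir e.level) e.lo e.hi :=
  maximal_carrier_iff

/-! ### Crossings -/

/-- The parameter is replaced by the coordinate `a + t * (b - a)`. This reverses the order when `b <
a`, which is why `Passages` uses an unordered finite set and `uIcc`. For `a = b` the map is not
injective, but then `ha` excludes any passage. -/
lemma hasExteriorPassages_iff {P : Set (ℝ × ℝ)} {d : Dir} {c a b : ℝ} {r : ℕ}
    (ha : pt d c a ∈ P) : HasExteriorPassages P (pt d c a) (pt d c b) r ↔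
      Passages (line P d c) (line (interior P) d c) a b r := by
  classical
  rcases eq_or_ne a b with rfl | hab
  · constructor
    · rintro ⟨t, h1, -⟩
      cases r with
      | zero => exact ⟨∅, rfl, by simp, by simp⟩
      | succ r =>
        refine absurd ha ?_
        simpa using (h1 0).2
    · intro h
      cases r with
      | zero => exact ⟨fun i => i.elim0, fun i => i.elim0, fun i => i.elim0⟩
      | succ r => exact absurd h (not_passages_of_uIcc_subset (by simpa using ha) r.succ_pos)
  have hf : ∀ t, AffineMap.lineMap a b t = a + t * (b - a) := fun t => by
    simp [AffineMap.lineMap_apply]; ring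
  have hne : b - a ≠ 0 := sub_ne_zero.2 hab.symm
  have hinj : Function.Injective fun t => a + t * (b - a) := fun x y h => by
    have : x * (b - a) = y * (b - a) := by simpa using h
    exact mul_right_cancel₀ hne this
  have hbet : ∀ x u y : ℝ, x < u → u < y →
      (x * (b - a) < u * (b - a) ∧ u * (b - a) < y * (b - a)) ∨
      (y * (b - a) < u * (b - a) ∧ u * (b - a) < x * (b - a)) := by
    intro x u y hxu huy
    rcases lt_or_gt_of_ne hne with h | h
    · exact .inr ⟨mul_lt_mul_of_neg_right huy h, mul_lt_mul_of_neg_right hxu h⟩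
    · exact .inl ⟨mul_lt_mul_of_pos_right hxu h, mul_lt_mul_of_pos_right huy h⟩
  constructor
  · rintro ⟨t, h1, h2⟩
    simp only [lineMap_pt, hf] at h1 h2
    have hmono : StrictMono t := fun i j hij => by
      obtain ⟨u, hu1, hu2, -⟩ := h2 i j hij
      exact hu1.trans hu2
    refine ⟨Finset.univ.image fun i => a + t i * (b - a), ?_, ?_, ?_⟩
    · exact (Finset.card_image_of_injective _ (hinj.comp hmono.injective)).trans (by simp)
    · intro x hx
      obtain ⟨i, -, rfl⟩ := Finset.mem_image.1 hx
      refine ⟨?_, (h1 i).2⟩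
      obtain ⟨⟨h3, h4⟩, -⟩ := h1 i
      rw [mem_uIcc]
      rcases lt_or_gt_of_ne hne with h | h
      · exact .inr ⟨by nlinarith, by nlinarith⟩
      · exact .inl ⟨by nlinarith, by nlinarith⟩
    · intro x hx y hy hxy
      obtain ⟨i, -, rfl⟩ := Finset.mem_image.1 hx
      obtain ⟨j, -, rfl⟩ := Finset.mem_image.1 hy
      rcases lt_trichotomy i j with hij | rfl | hij
      · obtain ⟨u, hu1, hu2, hu3⟩ := h2 i j hij
        exact ⟨_, hu3, by rcases hbet _ _ _ hu1 hu2 with h | h <;> constructor <;> linarith⟩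
      · exact absurd hxy (lt_irrefl _)
      · obtain ⟨u, hu1, hu2, hu3⟩ := h2 j i hij
        exact ⟨_, hu3, by rcases hbet _ _ _ hu1 hu2 with h | h <;> constructor <;> linarith⟩
  · rintro ⟨E, rfl, h1, h2⟩
    have hg : ∀ x, a + (x - a) / (b - a) * (b - a) = x := fun x => by field_simp; ring
    set g : ℝ → ℝ := fun x => (x - a) / (b - a) with hgdef
    have hginj : Function.Injective g := fun x y h => by
      have h' : (x - a) / (b - a) = (y - a) / (b - a) := h
      rw [← hg x, ← hg y, h']
    have hcard : (E.image g).card = E.card := Finset.card_image_of_injective _ hginj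
    have hmem : ∀ i, ∃ x ∈ E, g x = (E.image g).orderEmbOfFin hcard i := fun i =>
      Finset.mem_image.1 (Finset.orderEmbOfFin_mem _ hcard i)
    refine ⟨(E.image g).orderEmbOfFin hcard, fun i => ?_, fun i j hij => ?_⟩
    · obtain ⟨x, hx, hxi⟩ := hmem i
      rw [← hxi, lineMap_pt, hf, hg]
      refine ⟨?_, (h1 x hx).2⟩
      rcases mem_uIcc.1 (h1 x hx).1 with h | h
      · have : 0 < b - a := lt_of_le_of_ne (by linarith) hne.symm
        exact ⟨div_nonneg (by linarith) this.le, (div_le_one this).2 (by linarith)⟩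
      · have : b - a < 0 := lt_of_le_of_ne (by linarith) hne
        exact ⟨div_nonneg_of_nonpos (by linarith) this.le, (div_le_one_of_neg this).2 (by linarith)⟩
    · have hlt : (E.image g).orderEmbOfFin hcard i < (E.image g).orderEmbOfFin hcard j := by
        simpa using hij
      obtain ⟨x, hx, hxi⟩ := hmem i
      obtain ⟨y, hy, hyj⟩ := hmem j
      rw [← hxi, ← hyj] at hlt ⊢
      have hdiv : ∀ u v : ℝ, 0 < b - a → u < v → g u < g v := fun u v h huv =>
        div_lt_div_of_pos_right (by linarith) h
      have hdiv' : ∀ u v : ℝ, b - a < 0 → u < v → g v < g u := fun u v h huv =>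
        div_lt_div_of_neg_of_lt h (by linarith)
      rcases lt_or_gt_of_ne hne with h | h
      · have hxy : y < x := by
          rcases lt_trichotomy x y with h' | h' | h'
          · exact absurd hlt (hdiv' x y h h').not_gt
          · exact absurd hlt (by rw [h']; exact lt_irrefl _)
          · exact h'
        obtain ⟨u, hu, h3, h4⟩ := h2 y hy x hx hxy
        exact ⟨g u, hdiv' _ _ h h4, hdiv' _ _ h h3, by rw [lineMap_pt, hf, hg]; exact hu⟩
      · have hxy : x < y := by
          rcases lt_trichotomy x y with h' | h' | h'
          · exact h'
          · exact absurd hlt (by rw [h']; exact lt_irrefl _)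
          · exact absurd hlt (hdiv y x h h').not_gt
        obtain ⟨u, hu, h3, h4⟩ := h2 x hx y hy hxy
        exact ⟨g u, hdiv _ _ h h3, hdiv _ _ h h4, by rw [lineMap_pt, hf, hg]; exact hu⟩

/-- Crossings come in pairs and passage counts are closed downwards, so the bound `k` first fails at
`k / 2 + 1` passages. -/
lemma crossings_le_iff {P : Set (ℝ × ℝ)} {d : Dir} {c a b : ℝ} {k : ℕ} (ha : pt d c a ∈ P) :
    crossings P (pt d c a) (pt d c b) ≤ k ↔
      ¬ Passages (line P d c) (line (interior P) d c) a b (k / 2 + 1) := by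
  simp only [crossings, iSup_le_iff, hasExteriorPassages_iff ha, Nat.cast_le]
  constructor
  · intro h hp
    have := h _ hp
    omega
  · intro h r hr
    by_contra hcon
    exact h (hr.of_le (by omega))

/-! ### The polygon near a line -/

/-- `U` and `L` are the traces of `P` on the parallels just above and just below a line. -/
structure Sides (P : Set (ℝ × ℝ)) (d : Dir) (c : ℝ) (U L : Set ℝ) : Prop where
  tame_above : Tame U
  tame_below : Tame L
  line_eq : line P d c = U ∪ L
  line_interior : line (interior P) d c = interior U ∩ interior L
  near : ∃ ε > 0, (∀ c' ∈ Ioo c (c + ε), line P d c' = U ∧ line (interior P) d c' = interior U) ∧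
    ∀ c' ∈ Ioo (c - ε) c, line P d c' = L ∧ line (interior P) d c' = interior L

/-- Balls of the product metric are boxes, so interior points can be tested line by line. -/
lemma mem_line_interior {P : Set (ℝ × ℝ)} {d : Dir} {c t : ℝ} :
    t ∈ line (interior P) d c ↔
      ∃ ε > 0, ∀ c' ∈ Ioo (c - ε) (c + ε), Ioo (t - ε) (t + ε) ⊆ line P d c' := by
  have hb : ∀ q : ℝ × ℝ, ∀ ε : ℝ, q ∈ Metric.ball (pt d c t) ε ↔
      coord d.perp q ∈ Ioo (c - ε) (c + ε) ∧ coord d q ∈ Ioo (t - ε) (t + ε) := by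
    intro q ε
    rw [← Real.ball_eq_Ioo, ← Real.ball_eq_Ioo]
    cases d
    · simp [pt, coord, Dir.perp, Prod.dist_eq, and_comm]
    · simp [pt, coord, Dir.perp, Prod.dist_eq]
  rw [mem_line, mem_interior_iff_mem_nhds, Metric.mem_nhds_iff]
  refine exists_congr fun ε => and_congr Iff.rfl ⟨fun h c' hc' t' ht' => ?_, fun h q hq => ?_⟩
  · exact h ((hb _ _).2 ⟨by simpa using hc', by simpa using ht'⟩)
  · obtain ⟨h1, h2⟩ := (hb _ _).1 hq
    have := h _ h1 h2
    simpa using this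

/-- The trace on the parallels just above. -/
def sideAbove (F : Finset ((ℝ × ℝ) × (ℝ × ℝ))) (d : Dir) (c : ℝ) : Set ℝ :=
  ⋃ r ∈ F, {t | (coord d.perp r.1 ≤ c ∧ c < coord d.perp r.2) ∧ t ∈ Icc (coord d r.1) (coord d r.2)}

/-- The trace on the parallels just below. -/
def sideBelow (F : Finset ((ℝ × ℝ) × (ℝ × ℝ))) (d : Dir) (c : ℝ) : Set ℝ :=
  ⋃ r ∈ F, {t | (coord d.perp r.1 < c ∧ c ≤ coord d.perp r.2) ∧ t ∈ Icc (coord d r.1) (coord d r.2)}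

/-- Each of the finitely many rectangles either meets all lines slightly above level `c` or none of
them, and likewise below. On a strip where the trace is a constant set `S`, the trace of the
interior is `interior S`; at level `c` itself an interior point needs room on both sides. -/
lemma sides_of_eq_biUnion {P : Set (ℝ × ℝ)} {F : Finset ((ℝ × ℝ) × (ℝ × ℝ))}
    (hF : ∀ r ∈ F, r.1.1 < r.2.1 ∧ r.1.2 < r.2.2) (hP : P = ⋃ r ∈ F, Icc r.1 r.2) (d : Dir) (c : ℝ) :
    Sides P d c (sideAbove F d c) (sideBelow F d c) := by
  have hFd : ∀ d' : Dir, ∀ r ∈ F, coord d' r.1 < coord d' r.2 := by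
    intro d' r hr
    cases d'
    exacts [(hF r hr).1, (hF r hr).2]
  have hline : ∀ c t, t ∈ line P d c ↔ ∃ r ∈ F, (coord d.perp r.1 ≤ c ∧ c ≤ coord d.perp r.2) ∧
      t ∈ Icc (coord d r.1) (coord d r.2) := by
    intro c t
    rw [mem_line, hP]
    simp only [mem_iUnion, mem_Icc, exists_prop, Prod.le_def]
    refine exists_congr fun r => and_congr Iff.rfl ?_
    cases d <;> simp only [pt, coord, Dir.perp] <;> tauto
  have tame : ∀ p : (ℝ × ℝ) × (ℝ × ℝ) → Prop,
      Tame (⋃ r ∈ F, {t | p r ∧ t ∈ Icc (coord d r.1) (coord d r.2)}) := by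
    intro p
    refine Tame.biUnion F _ fun r hr => ?_
    by_cases hp : p r
    · simpa [hp] using! Tame.Icc (hFd d r hr)
    · simpa [hp] using Tame.empty
  have hlineU : ∀ᶠ c' in 𝓝[>] c, line P d c' = sideAbove F d c := by
    have : ∀ᶠ c' in 𝓝[>] c, ∀ r ∈ F, (coord d.perp r.1 ≤ c' ∧ c' ≤ coord d.perp r.2) ↔
        (coord d.perp r.1 ≤ c ∧ c < coord d.perp r.2) := by
      rw [Filter.eventually_all_finset]
      intro r hr
      have h1 : ∀ᶠ c' in 𝓝[>] c, (coord d.perp r.1 ≤ c' ↔ coord d.perp r.1 ≤ c) := by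
        rcases lt_or_ge c (coord d.perp r.1) with h | h
        · filter_upwards [Ioo_mem_nhdsGT h] with c' hc'
          exact iff_of_false hc'.2.not_ge h.not_ge
        · filter_upwards [self_mem_nhdsWithin] with c' hc'
          exact iff_of_true (h.trans (le_of_lt hc')) h
      have h2 : ∀ᶠ c' in 𝓝[>] c, (c' ≤ coord d.perp r.2 ↔ c < coord d.perp r.2) := by
        rcases lt_or_ge c (coord d.perp r.2) with h | h
        · filter_upwards [Ioo_mem_nhdsGT h] with c' hc'
          exact iff_of_true hc'.2.le h
        · filter_upwards [self_mem_nhdsWithin] with c' hc'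
          exact iff_of_false (h.trans_lt hc').not_ge h.not_gt
      filter_upwards [h1, h2] with c' h3 h4
      exact and_congr h3 h4
    filter_upwards [this] with c' hc'
    ext t
    simp only [hline, sideAbove, mem_iUnion, mem_ofPred_eq, exists_prop]
    exact exists_congr fun r => and_congr_right fun hr => and_congr (hc' r hr) Iff.rfl
  have hlineL : ∀ᶠ c' in 𝓝[<] c, line P d c' = sideBelow F d c := by
    have : ∀ᶠ c' in 𝓝[<] c, ∀ r ∈ F, (coord d.perp r.1 ≤ c' ∧ c' ≤ coord d.perp r.2) ↔
        (coord d.perp r.1 < c ∧ c ≤ coord d.perp r.2) := by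
      rw [Filter.eventually_all_finset]
      intro r hr
      have h1 : ∀ᶠ c' in 𝓝[<] c, (c' ≤ coord d.perp r.2 ↔ c ≤ coord d.perp r.2) := by
        rcases lt_or_ge (coord d.perp r.2) c with h | h
        · filter_upwards [Ioo_mem_nhdsLT h] with c' hc'
          exact iff_of_false hc'.1.not_ge h.not_ge
        · filter_upwards [self_mem_nhdsWithin] with c' hc'
          exact iff_of_true ((le_of_lt hc').trans h) h
      have h2 : ∀ᶠ c' in 𝓝[<] c, (coord d.perp r.1 ≤ c' ↔ coord d.perp r.1 < c) := by
        rcases lt_or_ge (coord d.perp r.1) c with h | h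
        · filter_upwards [Ioo_mem_nhdsLT h] with c' hc'
          exact iff_of_true hc'.1.le h
        · filter_upwards [self_mem_nhdsWithin] with c' hc'
          exact iff_of_false (lt_of_lt_of_le hc' h).not_ge h.not_gt
      filter_upwards [h1, h2] with c' h3 h4
      exact and_congr h4 h3
    filter_upwards [this] with c' hc'
    ext t
    simp only [hline, sideBelow, mem_iUnion, mem_ofPred_eq, exists_prop]
    exact exists_congr fun r => and_congr_right fun hr => and_congr (hc' r hr) Iff.rfl
  have hUL : line P d c = sideAbove F d c ∪ sideBelow F d c := by
    ext t
    simp only [hline, sideAbove, sideBelow, mem_union, mem_iUnion, mem_ofPred_eq, exists_prop]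
    constructor
    · rintro ⟨r, hr, ⟨h1, h2⟩, h3⟩
      rcases lt_or_ge c (coord d.perp r.2) with h | h
      · exact .inl ⟨r, hr, ⟨h1, h⟩, h3⟩
      -- A rectangle that ends at level `c` starts strictly below it, so it contributes to the lower
      -- side.
      · exact .inr ⟨r, hr, ⟨(hFd _ r hr).trans_le h, h2⟩, h3⟩
    · rintro (⟨r, hr, ⟨h1, h2⟩, h3⟩ | ⟨r, hr, ⟨h1, h2⟩, h3⟩)
      · exact ⟨r, hr, ⟨h1, h2.le⟩, h3⟩
      · exact ⟨r, hr, ⟨h1.le, h2⟩, h3⟩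
  obtain ⟨bU, hbU, hU⟩ := mem_nhdsGT_iff_exists_Ioo_subset.1 hlineU
  obtain ⟨bL, hbL, hL⟩ := mem_nhdsLT_iff_exists_Ioo_subset.1 hlineL
  have hbU' : c < bU := hbU
  have hbL' : bL < c := hbL
  have hU' : ∀ c' ∈ Ioo c bU, line P d c' = sideAbove F d c := fun c' h => hU h
  have hL' : ∀ c' ∈ Ioo bL c, line P d c' = sideBelow F d c := fun c' h => hL h
  have hconst : ∀ (a b : ℝ) (S : Set ℝ), (∀ c' ∈ Ioo a b, line P d c' = S) →
      ∀ c' ∈ Ioo a b, line (interior P) d c' = interior S := by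
    intro a b S h c' hc'
    ext t
    rw [mem_line_interior, mem_interior_iff_mem_nhds, Metric.mem_nhds_iff]
    constructor
    · rintro ⟨ε, hε, hs⟩
      refine ⟨ε, hε, ?_⟩
      rw [Real.ball_eq_Ioo, ← h c' hc']
      exact hs c' ⟨by linarith, by linarith⟩
    · rintro ⟨ε, hε, hs⟩
      have hm : 0 < min ε (min (c' - a) (b - c')) :=
        lt_min hε (lt_min (by linarith [hc'.1]) (by linarith [hc'.2]))
      refine ⟨min ε (min (c' - a) (b - c')), hm, fun c'' hc'' => ?_⟩
      have h1 := min_le_left ε (min (c' - a) (b - c'))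
      have h2 := (min_le_right ε (min (c' - a) (b - c'))).trans (min_le_left _ _)
      have h3 := (min_le_right ε (min (c' - a) (b - c'))).trans (min_le_right _ _)
      rw [h c'' ⟨by linarith [hc''.1], by linarith [hc''.2]⟩]
      refine Subset.trans ?_ hs
      rw [Real.ball_eq_Ioo]
      exact Ioo_subset_Ioo (by linarith) (by linarith)
  refine ⟨tame _, tame _, hUL, ?_, min (bU - c) (c - bL), lt_min (by linarith) (by linarith), ?_, ?_⟩
  · ext t
    rw [mem_line_interior]
    constructor
    · rintro ⟨ε, hε, hs⟩
      have ht : t ∈ Ioo (t - ε) (t + ε) := ⟨by linarith, by linarith⟩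
      obtain ⟨u, hu1, hu2⟩ := exists_between (lt_min hbU' (by linarith : c < c + ε))
      obtain ⟨v, hv1, hv2⟩ := exists_between (max_lt hbL' (by linarith : c - ε < c))
      have hsu := hs u ⟨by linarith, hu2.trans_le (min_le_right _ _)⟩
      have hsv := hs v ⟨(le_max_right _ _).trans_lt hv1, by linarith⟩
      rw [hU' u ⟨hu1, hu2.trans_le (min_le_left _ _)⟩] at hsu
      rw [hL' v ⟨(le_max_left _ _).trans_lt hv1, hv2⟩] at hsv
      exact ⟨interior_maximal hsu isOpen_Ioo ht, interior_maximal hsv isOpen_Ioo ht⟩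
    · rintro ⟨h1, h2⟩
      obtain ⟨ε₁, hε₁, hs₁⟩ := Metric.mem_nhds_iff.1 (mem_interior_iff_mem_nhds.1 h1)
      obtain ⟨ε₂, hε₂, hs₂⟩ := Metric.mem_nhds_iff.1 (mem_interior_iff_mem_nhds.1 h2)
      rw [Real.ball_eq_Ioo] at hs₁ hs₂
      obtain ⟨ε, hε, hlt⟩ := exists_between
        (lt_min (lt_min hε₁ hε₂) (lt_min (sub_pos.2 hbU') (sub_pos.2 hbL')))
      simp only [lt_min_iff] at hlt
      refine ⟨ε, hε, fun c' hc' => ?_⟩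
      have e₁ : Ioo (t - ε) (t + ε) ⊆ sideAbove F d c :=
        (Ioo_subset_Ioo (by linarith) (by linarith)).trans hs₁
      have e₂ : Ioo (t - ε) (t + ε) ⊆ sideBelow F d c :=
        (Ioo_subset_Ioo (by linarith) (by linarith)).trans hs₂
      rcases lt_trichotomy c' c with h | rfl | h
      · rwa [hL' c' ⟨by linarith [hc'.1], h⟩]
      · rw [hUL]
        exact fun u hu => .inl (e₁ hu)
      · rwa [hU' c' ⟨h, by linarith [hc'.2]⟩]
  · intro c' hc'
    have h : c' ∈ Ioo c bU := ⟨hc'.1, by linarith [hc'.2, min_le_left (bU - c) (c - bL)]⟩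
    exact ⟨hU' c' h, hconst _ _ _ hU' c' h⟩
  · intro c' hc'
    have h : c' ∈ Ioo bL c := ⟨by linarith [hc'.1, min_le_right (bU - c) (c - bL)], hc'.2⟩
    exact ⟨hL' c' h, hconst _ _ _ hL' c' h⟩

lemma IsOrthogonalPolygon.exists_sides {P : Set (ℝ × ℝ)} (hP : IsOrthogonalPolygon P) (d : Dir)
    (c : ℝ) : ∃ U L, Sides P d c U L := by
  obtain ⟨F, hF, h⟩ := hP.finite_union
  exact ⟨_, _, sides_of_eq_biUnion hF h d c⟩

lemma IsOrthogonalPolygon.isCompact {P : Set (ℝ × ℝ)} (hP : IsOrthogonalPolygon P) :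
    IsCompact P := by
  obtain ⟨F, -, rfl⟩ := hP.finite_union
  exact F.isCompact_biUnion fun r _ => isCompact_Icc

lemma Sides.line_frontier {P : Set (ℝ × ℝ)} {d : Dir} {c : ℝ} {U L : Set ℝ} (h : Sides P d c U L)
    (hP : IsClosed P) : line (frontier P) d c = bdry U L := by
  rw [bdry, ← h.line_eq, ← h.line_interior, hP.frontier_eq]
  rfl

/-- The edges of a given direction lie on finitely many lines. -/
lemma IsOrthogonalPolygon.finite_edge_levels {P : Set (ℝ × ℝ)} (hP : IsOrthogonalPolygon P)
    (d : Dir) : ∃ Y : Set ℝ, Y.Finite ∧ ∀ e, IsEdge P e → e.dir = d → e.level ∈ Y := by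
  obtain ⟨F, hF, h⟩ := hP.finite_union
  refine ⟨(fun r => coord d.perp r.1) '' (F : Set ((ℝ × ℝ) × (ℝ × ℝ))) ∪
      (fun r => coord d.perp r.2) '' (F : Set ((ℝ × ℝ) × (ℝ × ℝ))),
    (F.finite_toSet.image _).union (F.finite_toSet.image _), ?_⟩
  rintro e he rfl
  by_contra hY
  have hs := sides_of_eq_biUnion hF h e.dir e.level
  have hedge := (isEdge_iff.1 he).1
  rw [hs.line_frontier hP.isCompact.isClosed] at hedge
  obtain ⟨x, hx⟩ := exists_disagree_of_Icc_subset_bdry hs.tame_above hs.tame_below e.lo_lt_hi hedge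
  -- At a level that is neither the bottom nor the top of a rectangle, the two sides are the same
  -- set, whereas an edge forces them to differ.
  refine hx ?_
  simp only [sideAbove, sideBelow, mem_iUnion, mem_ofPred_eq, exists_prop]
  refine exists_congr fun r => and_congr_right fun hr => and_congr (and_congr ?_ ?_) Iff.rfl
  · exact ⟨fun h => lt_of_le_of_ne h fun h' => hY (.inl ⟨r, hr, h'⟩), le_of_lt⟩
  · exact ⟨le_of_lt, fun h => lt_of_le_of_ne h fun h' => hY (.inr ⟨r, hr, h'.symm⟩)⟩

variable {P : Set (ℝ × ℝ)} {k : ℕ} {d : Dir}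

/-! ### Visibility along a line -/

/-- The point with coordinate `t` on the line of direction `d` through `p` belongs to `P`, and the
segment from `p` to it crosses the boundary at most `k` times. -/
def Visible (P : Set (ℝ × ℝ)) (k : ℕ) (d : Dir) (p : ℝ × ℝ) (t : ℝ) : Prop :=
  pt d (coord d.perp p) t ∈ P ∧
    ¬ Passages (line P d (coord d.perp p)) (line (interior P) d (coord d.perp p)) (coord d p) t
      (k / 2 + 1)

lemma visible_of_uIcc_subset {p : ℝ × ℝ} {t : ℝ}
    (h : uIcc (coord d p) t ⊆ line P d (coord d.perp p)) : Visible P k d p t :=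
  ⟨h right_mem_uIcc, not_passages_of_uIcc_subset h (Nat.succ_pos _)⟩

/-- Visibility is unchanged if the target moves inside `P`. -/
lemma Visible.move_right {p : ℝ × ℝ} {t t' : ℝ} (h : Visible P k d p t)
    (hs : uIcc t t' ⊆ line P d (coord d.perp p)) : Visible P k d p t' :=
  ⟨hs right_mem_uIcc, fun hp => h.2 (hp.move_right (by rwa [uIcc_comm]))⟩

/-- A transmitter looks perpendicularly to itself: the line of sight has level `coord s.dir p`, and
`s.level` is the coordinate of its foot. -/
lemma sees_iff {s : Seg} {p : ℝ × ℝ} (hp : p ∈ P)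
    (hs : coord s.dir p ∈ Icc s.lo s.hi → pt s.dir s.level (coord s.dir p) ∈ P) :
    Sees P k s p ↔ coord s.dir p ∈ Icc s.lo s.hi ∧ Visible P k s.dir.perp p s.level := by
  refine and_congr_right fun h => ?_
  have h1 : pt s.dir.perp (coord s.dir p) (coord s.dir.perp p) = p := by
    rw [pt_perp, pt_coord]
  rw [Visible, Dir.perp_perp, pt_perp, and_iff_right (hs h)]
  have := crossings_le_iff (P := P) (d := s.dir.perp) (c := coord s.dir p)
    (a := coord s.dir.perp p) (b := s.level) (k := k) (by rwa [h1])
  rw [h1, pt_perp] at this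
  exact this

lemma hitFwd_iff (hP : IsClosed P) {c t : ℝ} :
    HitFwd P d c t ↔ HitsUp (line P d c) (line (interior P) d c) t := by
  rw [HitFwd, hP.frontier_eq]
  rfl

lemma hitBwd_iff (hP : IsClosed P) {c t : ℝ} :
    HitBwd P d c t ↔ HitsDown (line P d c) (line (interior P) d c) t := by
  rw [HitBwd, hP.frontier_eq]
  rfl

lemma isClosed_line {K : Set (ℝ × ℝ)} (hK : IsClosed K) (c : ℝ) : IsClosed (line K d c) :=
  hK.preimage ((continuous_pt d).comp (Continuous.prodMk_right c))

lemma isOpen_line {K : Set (ℝ × ℝ)} (hK : IsOpen K) (c : ℝ) : IsOpen (line K d c) :=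
  hK.preimage ((continuous_pt d).comp (Continuous.prodMk_right c))

lemma line_interior_subset (c : ℝ) : line (interior P) d c ⊆ line P d c :=
  preimage_mono interior_subset

lemma isCompact_line (hP : IsCompact P) (c : ℝ) : IsCompact (line P d c) := by
  have : line P d c ⊆ coord d '' P := fun t ht => ⟨pt d c t, ht, coord_pt d c t⟩
  exact (hP.image (continuous_coord d)).of_isClosed_subset (isClosed_line hP.isClosed c) this

/-- No edge behind `a` is close enough for its extension to reach `a`. -/
lemma le_encard_hitsUp_of_mem_cutInterior (hP : IsCompact P) {c a lo hi : ℝ}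
    (ha : pt d c a ∈ cutInterior P k d) (hlt : lo < hi) (hia : hi < a)
    (hmax : IsMaxIcc (line (frontier P) d c) lo hi) :
    ((k / 2 + 1 : ℕ) : ℕ∞) ≤
      {u | hi < u ∧ u < a ∧ HitsUp (line P d c) (line (interior P) d c) u}.encard := by
  by_contra hcon
  obtain ⟨y, hy⟩ := (isCompact_line (d := d) hP c).bddAbove
  -- `h` is the first hit after `a`; it exists since `P` is bounded by `y` on this line. There is no
  -- hit in `[a, h)`, so with too few hits before `a` the extension of the edge would reach `h` and
  -- contain `a`.
  obtain ⟨h, h1, -, h3, h4⟩ := exists_hitsUp (isClosed_line hP.isClosed c)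
    (isOpen_line isOpen_interior c) (line_interior_subset c) (x := a) (y := max a (y + 1)) ha.1
    (fun h => by
      have := hy (line_interior_subset c h)
      linarith [le_max_right a (y + 1)]) (le_max_left _ _)
  refine ha.2 (mem_iUnion₂.2 ⟨⟨d, c, lo, hi, hlt⟩, ⟨isEdge_iff.2 hmax, rfl⟩, lo, h, .inl rfl,
    .inr ⟨hia.trans h1, (hitFwd_iff hP.isClosed).2 h3, ?_⟩, a, ⟨(hlt.trans hia).le, h1.le⟩, rfl⟩)
  refine lt_of_le_of_lt (Set.encard_le_encard ?_) (not_le.1 hcon)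
  rintro u ⟨hu1, hu2, hu3⟩
  rw [hitFwd_iff hP.isClosed] at hu3
  exact ⟨hu1, not_le.1 fun h => hu3.1.2 (h4 ⟨h, hu2⟩), hu3⟩

lemma le_encard_hitsDown_of_mem_cutInterior (hP : IsCompact P) {c a lo hi : ℝ}
    (ha : pt d c a ∈ cutInterior P k d) (hlt : lo < hi) (hia : a < lo)
    (hmax : IsMaxIcc (line (frontier P) d c) lo hi) :
    ((k / 2 + 1 : ℕ) : ℕ∞) ≤
      {u | a < u ∧ u < lo ∧ HitsDown (line P d c) (line (interior P) d c) u}.encard := by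
  by_contra hcon
  obtain ⟨y, hy⟩ := (isCompact_line (d := d) hP c).bddBelow
  obtain ⟨h, h1, -, h3, h4⟩ := exists_hitsDown (isClosed_line hP.isClosed c)
    (isOpen_line isOpen_interior c) (line_interior_subset c) (x := a) (y := min a (y - 1)) ha.1
    (fun h => by
      have := hy (line_interior_subset c h)
      linarith [min_le_right a (y - 1)]) (min_le_left _ _)
  refine ha.2 (mem_iUnion₂.2 ⟨⟨d, c, lo, hi, hlt⟩, ⟨isEdge_iff.2 hmax, rfl⟩, h, hi,
    .inr ⟨h1.trans hia, (hitBwd_iff hP.isClosed).2 h3, ?_⟩, .inl rfl, a, ⟨h1.le, (hia.trans hlt).le⟩,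
    rfl⟩)
  refine lt_of_le_of_lt (Set.encard_le_encard ?_) (not_le.1 hcon)
  rintro u ⟨hu1, hu2, hu3⟩
  rw [hitBwd_iff hP.isClosed] at hu3
  exact ⟨not_le.1 fun h => hu3.1.2 (h4 ⟨hu1, h⟩), hu2, hu3⟩

/-- From a point of a slice, one sees nothing beyond a place where the two sides of the line
differ. -/
lemma exists_passages_of_disagree (hP : IsCompact P) {c a t : ℝ} {U L : Set ℝ}
    (hs : Sides P d c U L) (ha : pt d c a ∈ cutInterior P k d) (ht : ¬ Agree U L a t) :
    ∃ t₀ ∈ uIcc a t, Agree U L a t₀ ∧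
      Passages (line P d c) (line (interior P) d c) a t₀ (k / 2 + 1) := by
  have hz : a ∈ line (interior P) d c := ha.1
  have hl := fun lo hi => le_encard_hitsUp_of_mem_cutInterior (lo := lo) (hi := hi) hP ha
  have hr := fun lo hi => le_encard_hitsDown_of_mem_cutInterior (lo := lo) (hi := hi) hP ha
  rw [hs.line_frontier hP.isClosed] at hl hr
  rw [hs.line_eq, hs.line_interior] at hl hr ⊢
  rw [hs.line_interior] at hz
  have ht' : ∃ x ∈ uIcc a t, ¬ (x ∈ U ↔ x ∈ L) := by
    by_contra hcon
    exact ht fun x hx => not_not.1 fun h => hcon ⟨x, hx, h⟩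
  obtain ⟨x, hx, hbad⟩ := ht'
  have hsub : uIcc a x ⊆ uIcc a t := uIcc_subset_uIcc_left hx
  rcases le_total x a with h | h
  · obtain ⟨t₀, h1, h2⟩ := exists_passages_of_disagree_left hs.tame_above hs.tame_below
      (Nat.succ_pos (k / 2)) hz h hbad hl
    exact ⟨t₀, hsub h1, h2⟩
  · obtain ⟨t₀, h1, h2⟩ := exists_passages_of_disagree_right hs.tame_above hs.tame_below
      (Nat.succ_pos (k / 2)) hz h hbad hr
    exact ⟨t₀, hsub h1, h2⟩

lemma mem_interior_iff_of_agree {U L : Set ℝ} {a b x : ℝ} (h : Agree U L a b)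
    (hx : x ∈ uIoo a b) : x ∈ interior U ↔ x ∈ interior L := by
  have hev : ∀ᶠ y in 𝓝 x, y ∈ U ↔ y ∈ L := by
    filter_upwards [isOpen_Ioo.mem_nhds hx] with y hy
    exact h y (Ioo_subset_Icc_self hy)
  rw [mem_interior_iff_mem_nhds, mem_interior_iff_mem_nhds]
  exact eventually_congr hev

/-- As long as the two sides of a line agree, the neighbouring lines look the same. -/
lemma Sides.eventually_eq {c : ℝ} {U L : Set ℝ} (hs : Sides P d c U L) :
    ∀ᶠ c' in 𝓝 c, ∀ a b, Agree U L a b →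
      (∀ x ∈ uIcc a b, x ∈ line P d c' ↔ x ∈ line P d c) ∧
      ∀ x ∈ uIoo a b, x ∈ line (interior P) d c' ↔ x ∈ line (interior P) d c := by
  obtain ⟨ε, hε, hU, hL⟩ := hs.near
  filter_upwards [Ioo_mem_nhds (sub_lt_self c hε) (lt_add_of_pos_right c hε)] with c' hc' a b hag
  rcases lt_trichotomy c' c with h | rfl | h
  · obtain ⟨h1, h2⟩ := hL c' ⟨hc'.1, h⟩
    rw [h1, h2, hs.line_eq, hs.line_interior]
    refine ⟨fun x hx => ?_, fun x hx => ?_⟩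
    · rw [mem_union, hag x hx, or_self]
    · rw [mem_inter_iff, mem_interior_iff_of_agree hag hx, and_self]
  · exact ⟨fun _ _ => Iff.rfl, fun _ _ => Iff.rfl⟩
  · obtain ⟨h1, h2⟩ := hU c' ⟨h, hc'.2⟩
    rw [h1, h2, hs.line_eq, hs.line_interior]
    refine ⟨fun x hx => ?_, fun x hx => ?_⟩
    · rw [mem_union, hag x hx, or_self]
    · rw [mem_inter_iff, mem_interior_iff_of_agree hag hx, and_self]

/-- Visibility is locally constant on the slices. -/
lemma eventually_visible_iff (hP : IsOrthogonalPolygon P) {z : ℝ × ℝ}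
    (hz : z ∈ cutInterior P k d) :
    ∀ᶠ w in 𝓝 z, ∀ t, Visible P k d w t ↔ Visible P k d z t := by
  obtain ⟨U, L, hs⟩ := hP.exists_sides d (coord d.perp z)
  have hz' : pt d (coord d.perp z) (coord d z) ∈ cutInterior P k d := by rwa [pt_coord]
  have hzi : coord d z ∈ line (interior P) d (coord d.perp z) := by
    rw [mem_line, pt_coord]
    exact hz.1
  obtain ⟨ε, hε, hbox⟩ := mem_line_interior.1 hzi
  filter_upwards [(continuous_coord d.perp).continuousAt.eventually hs.eventually_eq,
    (continuous_coord d.perp).continuousAt.eventually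
      (Ioo_mem_nhds (sub_lt_self _ hε) (lt_add_of_pos_right _ hε)),
    (continuous_coord d).continuousAt.eventually
      (Ioo_mem_nhds (sub_lt_self _ hε) (lt_add_of_pos_right _ hε))] with w hw hw1 hw2 t
  have hmid : (coord d z) ∈ Ioo (coord d z - ε) (coord d z + ε) :=
    ⟨sub_lt_self _ hε, lt_add_of_pos_right _ hε⟩
  have hseg : uIcc (coord d w) (coord d z) ⊆ line P d (coord d.perp w) :=
    (ordConnected_Ioo.uIcc_subset hw2 hmid).trans (hbox _ hw1)
  -- The starting point can slide from the coordinate of `w` to that of `z`, because this stretch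
  -- lies in a box inside `P`.
  have hmove : Passages (line P d (coord d.perp w)) (line (interior P) d (coord d.perp w))
      (coord d w) t (k / 2 + 1) ↔ Passages (line P d (coord d.perp w))
      (line (interior P) d (coord d.perp w)) (coord d z) t (k / 2 + 1) :=
    ⟨fun h => h.move_left hseg, fun h => h.move_left (by rwa [uIcc_comm])⟩
  rw [Visible, Visible, hmove]
  have hcongr : ∀ t', Agree U L (coord d z) t' →
      (Passages (line P d (coord d.perp w)) (line (interior P) d (coord d.perp w))
        (coord d z) t' (k / 2 + 1) ↔
      Passages (line P d (coord d.perp z)) (line (interior P) d (coord d.perp z))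
        (coord d z) t' (k / 2 + 1)) := fun t' hag => by
    obtain ⟨h1, h2⟩ := hw _ _ hag
    exact ⟨fun h => h.congr (fun x hx => (h1 x hx).2) fun x hx => (h2 x hx).1,
      fun h => h.congr (fun x hx => (h1 x hx).1) fun x hx => (h2 x hx).2⟩
  by_cases hag : Agree U L (coord d z) t
  · exact and_congr ((hw _ _ hag).1 t right_mem_uIcc) (not_congr (hcongr t hag))
  -- The view is blocked at a point `t₀` up to which the sides still agree, so the block is also
  -- present on the line of `w`, and neither point sees `t`.
  · obtain ⟨t₀, ht₀, hag₀, hp⟩ := exists_passages_of_disagree hP.isCompact hs hz' hag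
    have hsub : uIcc (coord d z) t₀ ⊆ uIcc (coord d z) t := uIcc_subset_uIcc_left ht₀
    exact iff_of_false (fun h => h.2 (((hcongr t₀ hag₀).2 hp).mono hsub)) fun h => h.2 (hp.mono hsub)

/-- All points of a slice see the same. -/
lemma IsSlice.visible_iff (hP : IsOrthogonalPolygon P) {σ : Set (ℝ × ℝ)} (hσ : IsSlice P k d σ)
    {z w : ℝ × ℝ} (hz : z ∈ σ) (hw : w ∈ σ) (t : ℝ) :
    Visible P k d z t ↔ Visible P k d w t := by
  obtain ⟨z₀, -, rfl⟩ := hσ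
  refine isPreconnected_connectedComponentIn.induction₂
    (fun z w => ∀ t, Visible P k d z t ↔ Visible P k d w t) ?_ ?_ ?_ hz hw t
  · intro x hx
    have := eventually_visible_iff hP (connectedComponentIn_subset _ _ hx)
    exact (this.filter_mono nhdsWithin_le_nhds).mono fun w hw t => (hw t).symm
  · exact fun x y z _ _ _ h1 h2 t => (h1 t).trans (h2 t)
  · exact fun x y _ _ h t => (h t).symm

/-- What a point of a slice sees belongs to `P` across the whole slice. -/
lemma IsSlice.uIcc_subset_line (hP : IsOrthogonalPolygon P) {σ : Set (ℝ × ℝ)}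
    (hσ : IsSlice P k d σ) {z w : ℝ × ℝ} (hz : z ∈ σ) (hw : w ∈ σ) {t : ℝ}
    (ht : Visible P k d z t) : uIcc (coord d.perp z) (coord d.perp w) ⊆ line P d.perp t := by
  have hpre : IsPreconnected (coord d.perp '' σ) := by
    obtain ⟨z₀, -, rfl⟩ := hσ
    exact isPreconnected_connectedComponentIn.image _ (continuous_coord d.perp).continuousOn
  intro y hy
  obtain ⟨v, hv, rfl⟩ := hpre.ordConnected.uIcc_subset (mem_image_of_mem _ hz)
    (mem_image_of_mem _ hw) hy
  rw [mem_line, pt_perp]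
  exact ((hσ.visible_iff hP hz hv t).1 ht).1

/-- The extension of a segment inside a slice covers what is visible from the segment. -/
lemma Visible.mem_extension (hP : IsOrthogonalPolygon P) {r : Seg}
    (hr : r.carrier ⊆ cutInterior P k r.dir) {z : ℝ × ℝ} (hz : z ∈ r.carrier) {t : ℝ}
    (ht : Visible P k r.dir z t) : pt r.dir r.level t ∈ extension P k r := by
  obtain ⟨a, ha, rfl⟩ := hz
  rw [Visible, coord_pt, coord_perp_pt] at ht
  obtain ⟨ht, hnp⟩ := ht
  obtain ⟨U, L, hs⟩ := hP.exists_sides r.dir r.level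
  have hag : Agree U L a t := by
    by_contra hcon
    obtain ⟨t₀, ht₀, -, hp⟩ := exists_passages_of_disagree hP.isCompact hs
      (hr (mem_image_of_mem _ ha)) hcon
    exact hnp (hp.mono (uIcc_subset_uIcc_left ht₀))
  have htUL : t ∈ U ∪ L := by rw [← hs.line_eq]; exact ht
  have hcl := hP.isCompact.isClosed
  rcases lt_or_ge t r.lo with hlo | hlo
  · rw [hs.line_eq, hs.line_interior] at hnp
    obtain ⟨b, h1, h2, h3, h4⟩ := exists_hitsDown_of_not_passages hs.tame_above hs.tame_below ha.1
      hlo htUL hag hnp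
    rw [← hs.line_eq, ← hs.line_interior] at h3 h4
    simp only [← hitBwd_iff hcl] at h3 h4
    exact ⟨b, r.hi, .inr ⟨h1, h3, h4⟩, .inl rfl, t, ⟨h2, (hlo.trans r.lo_lt_hi).le⟩, rfl⟩
  rcases lt_or_ge r.hi t with hhi | hhi
  · rw [hs.line_eq, hs.line_interior] at hnp
    obtain ⟨b, h1, h2, h3, h4⟩ := exists_hitsUp_of_not_passages hs.tame_above hs.tame_below ha.2
      hhi htUL hag hnp
    rw [← hs.line_eq, ← hs.line_interior] at h3 h4
    simp only [← hitFwd_iff hcl] at h3 h4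
    exact ⟨r.lo, b, .inl rfl, .inr ⟨h1, h3, h4⟩, t, ⟨hlo, h2⟩, rfl⟩
  · exact ⟨r.lo, r.hi, .inl rfl, .inl rfl, t, ⟨hlo, hhi⟩, rfl⟩

/-- The points of `P` on the extension of a segment in the interior are visible from it. -/
lemma visible_of_mem_extension (hP : IsClosed P) {r : Seg} (hr : r.carrier ⊆ interior P)
    {z : ℝ × ℝ} (hz : z ∈ r.carrier) {t : ℝ} (ht : pt r.dir r.level t ∈ extension P k r)
    (htP : pt r.dir r.level t ∈ P) : Visible P k r.dir z t := by
  obtain ⟨a, ha, rfl⟩ := hz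
  rw [Visible, coord_pt, coord_perp_pt]
  refine ⟨htP, fun hp => ?_⟩
  have hB : Icc r.lo r.hi ⊆ line (interior P) r.dir r.level := carrier_subset_iff.1 hr
  have hA : Icc r.lo r.hi ⊆ line P r.dir r.level := hB.trans (line_interior_subset _)
  have hlo : r.lo ∈ Icc r.lo r.hi := left_mem_Icc.2 r.lo_lt_hi.le
  have hhi : r.hi ∈ Icc r.lo r.hi := right_mem_Icc.2 r.lo_lt_hi.le
  obtain ⟨a', b', ha', hb', u, hu, hut⟩ := ht
  obtain rfl : u = t := (pt_inj.1 hut).2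
  rcases lt_or_ge u r.lo with h1 | h1
  · rcases ha' with rfl | ⟨h3, h4, h5⟩
    · exact absurd hu.1 h1.not_ge
    have hp' := hp.move_left ((ordConnected_Icc.uIcc_subset ha hlo).trans hA)
    refine absurd h5 (not_lt.2 ((hp'.le_encard_hitsDown (isClosed_line hP _)
      (isOpen_line isOpen_interior _) (line_interior_subset _) (hB hlo) h1.le).trans
        (Set.encard_le_encard ?_)))
    rintro v ⟨hv1, hv2, hv3⟩
    exact ⟨hu.1.trans_lt hv1, hv2, (hitBwd_iff hP).2 hv3⟩
  rcases lt_or_ge r.hi u with h2 | h2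
  · rcases hb' with rfl | ⟨h3, h4, h5⟩
    · exact absurd hu.2 h2.not_ge
    have hp' := hp.move_left ((ordConnected_Icc.uIcc_subset ha hhi).trans hA)
    refine absurd h5 (not_lt.2 ((hp'.le_encard_hitsUp (isClosed_line hP _)
      (isOpen_line isOpen_interior _) (line_interior_subset _) (hB hhi) h2.le).trans
        (Set.encard_le_encard ?_)))
    rintro v ⟨hv1, hv2, hv3⟩
    exact ⟨hv1, hv2.trans_le hu.2, (hitFwd_iff hP).2 hv3⟩
  · exact not_passages_of_uIcc_subset
      ((ordConnected_Icc.uIcc_subset ha ⟨h1, h2⟩).trans hA) (Nat.succ_pos _) hp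

/-! ### Points in general position -/

/-- Having `r` exterior passages is an open condition: the points outside `P` and the separating
interior points lie in open sets, so the same parameters still work for nearby `p`. -/
lemma isClosed_setOf_sees (hP : IsClosed P) (s : Seg) : IsClosed {p | Sees P k s p} := by
  have hq : Continuous fun p => pt s.dir s.level (coord s.dir p) :=
    (continuous_pt s.dir).comp (continuous_const.prodMk (continuous_coord s.dir))
  have hlm : ∀ t : ℝ, Continuous fun p =>
      AffineMap.lineMap p (pt s.dir s.level (coord s.dir p)) t := fun t => by
    simp only [AffineMap.lineMap_apply_module]
    exact (continuous_id.const_smul (1 - t)).add (hq.const_smul t)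
  have hmain : IsClosed {p | crossings P p (pt s.dir s.level (coord s.dir p)) ≤ k} := by
    rw [← isOpen_compl_iff, isOpen_iff_mem_nhds]
    intro p hp
    have hex : ∃ r : ℕ, HasExteriorPassages P p (pt s.dir s.level (coord s.dir p)) r ∧
        ¬ ((2 * r : ℕ) : ℕ∞) ≤ k := by
      by_contra hcon
      refine hp (show crossings P p _ ≤ k from iSup₂_le fun r hr => ?_)
      by_contra h
      exact hcon ⟨r, hr, h⟩
    obtain ⟨r, ⟨t, h1, h2⟩, hr⟩ := hex
    choose! u hu1 hu2 hu3 using h2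
    have hev : ∀ᶠ p' in 𝓝 p,
        (∀ i, AffineMap.lineMap p' (pt s.dir s.level (coord s.dir p')) (t i) ∉ P) ∧
        ∀ i j, i < j →
          AffineMap.lineMap p' (pt s.dir s.level (coord s.dir p')) (u i j) ∈ interior P := by
      refine (eventually_all.2 fun i => ?_).and
        (eventually_all.2 fun i => eventually_all.2 fun j => ?_)
      · exact (hlm (t i)).continuousAt.eventually (hP.isOpen_compl.mem_nhds (h1 i).2)
      · by_cases hij : i < j
        · exact ((hlm (u i j)).continuousAt.eventually
            (isOpen_interior.mem_nhds (hu3 i j hij))).mono fun _ h _ => h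
        · exact Eventually.of_forall fun _ h => absurd h hij
    filter_upwards [hev] with p' ⟨h3, h4⟩ hle
    refine hr (le_trans ?_ hle)
    exact le_iSup₂_of_le r ⟨t, fun i => ⟨(h1 i).1, h3 i⟩, fun i j hij =>
      ⟨u i j, hu1 i j hij, hu2 i j hij, h4 i j hij⟩⟩ le_rfl
  exact (isClosed_Icc.preimage (continuous_coord s.dir)).inter hmain

/-- The points that lie in a slice of either direction are dense in `P`. -/
lemma IsOrthogonalPolygon.subset_closure_cutInterior (hP : IsOrthogonalPolygon P) (k : ℕ) :
    P ⊆ closure {p | ∀ d, p ∈ cutInterior P k d} := by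
  choose Y hY hYe using hP.finite_edge_levels
  -- Partition-segments lie on the lines of their edges, so a point off these finitely many lines is
  -- in slices of both directions.
  have hcut : ∀ p ∈ interior P, (∀ d : Dir, coord d.perp p ∉ Y d) → ∀ d, p ∈ cutInterior P k d := by
    intro p hp hpY d
    refine ⟨hp, fun h => ?_⟩
    obtain ⟨e, ⟨he, rfl⟩, a, b, -, -, t, -, rfl⟩ := mem_iUnion₂.1 h
    exact hpY e.dir (by rw [coord_perp_pt]; exact hYe _ e he rfl)
  have hdense : Dense ((Y .vertical)ᶜ ×ˢ (Y .horizontal)ᶜ : Set (ℝ × ℝ)) :=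
    ((hY _).countable.dense_compl ℝ).prod ((hY _).countable.dense_compl ℝ)
  obtain ⟨F, hF, h⟩ := hP.finite_union
  intro p hp
  have hp' := hp
  rw [h] at hp'
  obtain ⟨r, hr, hpr⟩ := mem_iUnion₂.1 hp'
  have hsub : Ioo r.1.1 r.2.1 ×ˢ Ioo r.1.2 r.2.2 ⊆ P := by
    rw [h]
    intro q hq
    exact mem_iUnion₂.2 ⟨r, hr, ⟨hq.1.1.le, hq.2.1.le⟩, ⟨hq.1.2.le, hq.2.2.le⟩⟩
  have hopen : IsOpen (Ioo r.1.1 r.2.1 ×ˢ Ioo r.1.2 r.2.2) := isOpen_Ioo.prod isOpen_Ioo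
  have hpc : p ∈ closure (Ioo r.1.1 r.2.1 ×ˢ Ioo r.1.2 r.2.2) := by
    rw [closure_prod_eq, closure_Ioo (hF r hr).1.ne, closure_Ioo (hF r hr).2.ne]
    exact ⟨⟨hpr.1.1, hpr.2.1⟩, ⟨hpr.1.2, hpr.2.2⟩⟩
  have := closure_mono (hdense.open_subset_closure_inter hopen) hpc
  rw [closure_closure] at this
  refine closure_mono ?_ this
  rintro q ⟨hq, hqY⟩
  refine hcut q (interior_maximal hsub hopen hq) fun d => ?_
  cases d
  exacts [hqY.2, hqY.1]

/-! ### Shifting a transmitter to a guard-segment -/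

lemma isGuardSegment_iff {g : Seg} : IsGuardSegment P g ↔
    (∃ e, IsEdge P e ∧ e.carrier ⊆ g.carrier) ∧
      IsMaxIcc (line P g.dir g.level) g.lo g.hi :=
  and_congr Iff.rfl maximal_carrier_iff

/-- A transmitter can be shifted inside `P` until it runs along an edge. -/
lemma IsTransmitter.exists_guardSegment (hP : IsOrthogonalPolygon P) {s : Seg}
    (hs : IsTransmitter P s) : ∃ g, IsGuardSegment P g ∧ g.dir = s.dir ∧
      Icc s.lo s.hi ⊆ Icc g.lo g.hi ∧
      ∀ t ∈ Icc s.lo s.hi, uIcc s.level g.level ⊆ line P s.dir.perp t := by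
  have hcl := hP.isCompact.isClosed
  have hs' : Icc s.lo s.hi ⊆ line P s.dir s.level := carrier_subset_iff.1 hs
  -- The levels to which `s` can be translated inside `P`. The transmitter moves down to the lowest
  -- level `c` of the maximal interval of `K` around its own level.
  set K : Set ℝ := ⋂ t ∈ Icc s.lo s.hi, line P s.dir.perp t with hK
  have hmemK : ∀ c, c ∈ K ↔ Icc s.lo s.hi ⊆ line P s.dir c := fun c => by
    simp only [hK, mem_iInter, mem_line, pt_perp]
    rfl
  have hKcl : IsClosed K := isClosed_biInter fun t _ => isClosed_line hcl t
  have hKc : IsCompact K := (isCompact_line (d := s.dir.perp) hP.isCompact s.lo).of_isClosed_subset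
    hKcl (biInter_subset_of_mem (left_mem_Icc.2 s.lo_lt_hi.le))
  obtain ⟨c, c', hcs, hsc', hmax⟩ := exists_isMaxIcc hKc (le_refl s.level) fun x hx => by
    rw [Icc_self, mem_singleton_iff] at hx
    rw [hx, hmemK]
    exact hs'
  have hcK : Icc s.lo s.hi ⊆ line P s.dir c :=
    (hmemK c).1 (hmax.1 ⟨le_rfl, hcs.trans hsc'⟩)
  obtain ⟨U, L, hsd⟩ := hP.exists_sides s.dir c
  -- Otherwise `s` could be moved a little below `c`.
  have hnot : ¬ Icc s.lo s.hi ⊆ L := by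
    intro hL
    obtain ⟨ε, hε, -, hnear⟩ := hsd.near
    have := (hmax.2 (c - ε / 2) c' (by linarith) le_rfl fun x hx => ?_).1
    · linarith
    · rcases lt_or_ge x c with h | h
      · rw [hmemK, (hnear x ⟨by linarith [hx.1], h⟩).1]
        exact hL
      · exact hmax.1 ⟨h, hx.2⟩
  obtain ⟨t, ht, htL⟩ := not_subset.1 hnot
  have hnhds : ∀ᶠ x in 𝓝 t, x ∉ L := hsd.tame_below.isCompact.isClosed.isOpen_compl.mem_nhds htL
  obtain ⟨ε, hε, hball⟩ := Metric.mem_nhds_iff.1 hnhds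
  rw [Real.ball_eq_Ioo] at hball
  have hlt := s.lo_lt_hi
  -- The part of the translated segment close to `t` has exterior just below it, hence lies in the
  -- boundary. It has positive length even if `t` is an end of `s`.
  have hab : max s.lo (t - ε / 2) < min s.hi (t + ε / 2) := by
    rw [max_lt_iff, lt_min_iff, lt_min_iff]
    exact ⟨⟨hlt, by linarith [ht.1]⟩, by linarith [ht.2], by linarith⟩
  have hfr : Icc (max s.lo (t - ε / 2)) (min s.hi (t + ε / 2)) ⊆ line (frontier P) s.dir c := by
    intro x hx
    rw [mem_Icc, max_le_iff, le_min_iff] at hx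
    rw [hsd.line_frontier hcl]
    refine ⟨?_, fun h => ?_⟩
    · rw [← hsd.line_eq]
      exact hcK ⟨hx.1.1, hx.2.1⟩
    · exact hball (show x ∈ Ioo (t - ε) (t + ε) from ⟨by linarith [hx.1.2], by linarith [hx.2.2]⟩)
        (interior_subset h.2)
  have hfrc : IsCompact (frontier P) := hP.isCompact.of_isClosed_subset isClosed_frontier
    hcl.frontier_subset
  obtain ⟨elo, ehi, helo, hehi, hemax⟩ := exists_isMaxIcc (isCompact_line hfrc c) hab.le hfr
  have heP : Icc elo ehi ⊆ line P s.dir c := hemax.1.trans (preimage_mono hcl.frontier_subset)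
  have helo' : elo ≤ s.hi := helo.trans (hab.le.trans (min_le_left _ _))
  have hehi' : s.lo ≤ ehi := (le_max_left _ _).trans (hab.le.trans hehi)
  -- The translated segment and the edge overlap, so their union is an interval in `P` and one
  -- guard-segment contains both.
  obtain ⟨glo, ghi, hglo, hghi, hgmax⟩ := exists_isMaxIcc (isCompact_line hP.isCompact c)
    ((min_le_left s.lo elo).trans (hlt.le.trans (le_max_left s.hi ehi))) (by
      intro x hx
      by_cases hxs : x ∈ Icc s.lo s.hi
      · exact hcK hxs
      · refine heP ?_
        have h1 := min_le_iff.1 hx.1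
        have h2 := le_max_iff.1 hx.2
        rw [mem_Icc, not_and_or, not_le, not_le] at hxs
        constructor <;> rcases hxs with h | h <;> rcases h1 with h1 | h1 <;>
          rcases h2 with h2 | h2 <;> linarith)
  have helt : elo < ehi := (helo.trans_lt hab).trans_le hehi
  have h1 : glo ≤ s.lo := hglo.trans (min_le_left _ _)
  have h2 : s.hi ≤ ghi := (le_max_left _ _).trans hghi
  refine ⟨⟨s.dir, c, glo, ghi, by linarith⟩, isGuardSegment_iff.2
    ⟨⟨⟨s.dir, c, elo, ehi, helt⟩, isEdge_iff.2 hemax, ?_⟩, hgmax⟩, rfl, Icc_subset_Icc h1 h2, ?_⟩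
  · exact image_mono (Icc_subset_Icc (hglo.trans (min_le_right _ _))
      ((le_max_right _ _).trans hghi))
  · intro y hy x hx
    rw [uIcc_of_ge hcs] at hx
    rw [mem_line, pt_perp]
    exact (hmemK x).1 (hmax.1 ⟨hx.1, hx.2.trans hsc'⟩) hy

/-! ### The equivalence -/

lemma IsSlice.subset_cutInterior {σ : Set (ℝ × ℝ)} (hσ : IsSlice P k d σ) :
    σ ⊆ cutInterior P k d := by
  obtain ⟨z, -, rfl⟩ := hσ
  exact connectedComponentIn_subset _ _

lemma Seg.pt_lo_mem_carrier (s : Seg) : pt s.dir s.level s.lo ∈ s.carrier :=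
  mem_image_of_mem _ (left_mem_Icc.2 s.lo_lt_hi.le)

/-- The slice-segment covers everything that is visible from the slice. -/
lemma Visible.mem_extension_of_isSlice (hP : IsOrthogonalPolygon P)
    {rep : Dir → Set (ℝ × ℝ) → Seg} (hrep : IsSelection P k rep) {σ : Set (ℝ × ℝ)}
    (hσ : IsSlice P k d σ) {p : ℝ × ℝ} (hp : p ∈ σ) {t : ℝ} (ht : Visible P k d p t) :
    pt d (rep d σ).level t ∈ extension P k (rep d σ) := by
  obtain ⟨hd, hsub⟩ := hrep d σ hσ
  generalize rep d σ = r at *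
  subst hd
  exact ((hσ.visible_iff hP hp (hsub r.pt_lo_mem_carrier) t).1 ht).mem_extension hP
    (hsub.trans hσ.subset_cutInterior) r.pt_lo_mem_carrier

/-- A guard-segment that sees a point of a pixel hits the cross of the pixel. -/
lemma Cross.hitBy_of_visible (hP : IsOrthogonalPolygon P) {rep : Dir → Set (ℝ × ℝ) → Seg}
    (hrep : IsSelection P k rep) (c : Cross P k rep) {g : Seg} (hg : IsGuardSegment P g)
    {p : ℝ × ℝ} (hp : p ∈ c.slice g.dir.perp) (hpg : coord g.dir p ∈ Icc g.lo g.hi)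
    (hv : Visible P k g.dir.perp p g.level) : c.HitBy g := by
  have hσ := c.isSlice g.dir.perp
  obtain ⟨hd, hsub⟩ := hrep _ _ hσ
  set r := rep g.dir.perp (c.slice g.dir.perp) with hr
  -- Moving across the slice from `p` to its selected segment, the seen point on the line of `g`
  -- stays in `P`; by maximality `g` contains this stretch and thus meets the slice-segment.
  have hline := hσ.uIcc_subset_line hP hp (hsub r.pt_lo_mem_carrier) hv
  rw [hd, coord_perp_pt, Dir.perp_perp] at hline
  have hmem := (isGuardSegment_iff.1 hg).2.mem_of_uIcc_subset hpg hline
  refine ⟨pt g.dir g.level r.level, pt_mem_carrier.2 ⟨rfl, hmem⟩, ?_⟩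
  have := hv.mem_extension_of_isSlice hP hrep hσ hp
  rwa [pt_perp] at this

/-- A guard-segment that meets the slice-segment of a slice sees all points of the slice. -/
lemma IsGuardSegment.sees_of_nonempty_inter (hP : IsOrthogonalPolygon P)
    {rep : Dir → Set (ℝ × ℝ) → Seg} (hrep : IsSelection P k rep) {g : Seg}
    (hg : IsGuardSegment P g) {σ : Set (ℝ × ℝ)} (hσ : IsSlice P k g.dir.perp σ)
    (hgσ : (g.carrier ∩ extension P k (rep g.dir.perp σ)).Nonempty) {p : ℝ × ℝ} (hp : p ∈ σ) :
    Sees P k g p := by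
  have hcl := hP.isCompact.isClosed
  obtain ⟨hd, hsub⟩ := hrep _ _ hσ
  set r := rep g.dir.perp σ with hr
  obtain ⟨_, ⟨t, ht, rfl⟩, hext⟩ := hgσ
  have htr : t = r.level := by
    obtain ⟨-, -, -, -, u, -, hu⟩ := hext
    rw [hd, pt_perp] at hu
    exact (pt_inj.1 hu).2.symm
  subst htr
  have hgP : pt g.dir g.level r.level ∈ P := hg.2.1 (mem_image_of_mem _ ht)
  have heq : pt g.dir g.level r.level = pt r.dir r.level g.level := by rw [hd, pt_perp]
  rw [heq] at hext hgP
  have hz := r.pt_lo_mem_carrier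
  have hv := visible_of_mem_extension hcl
    (hsub.trans (hσ.subset_cutInterior.trans sdiff_subset)) hz hext hgP
  have hline := fun h => hσ.uIcc_subset_line hP (hsub hz) hp (t := g.level) h
  rw [hd] at hv hline
  have hline := hline hv
  rw [coord_perp_pt, Dir.perp_perp] at hline
  have hmem := (isGuardSegment_iff.1 hg).2.mem_of_uIcc_subset ht hline
  have hpP : p ∈ P := interior_subset (hσ.subset_cutInterior hp).1
  rw [sees_iff hpP fun h => hg.2.1 (mem_image_of_mem _ h)]
  refine ⟨hmem, (hσ.visible_iff hP (hsub hz) hp _).1 ?_⟩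
  rw [hd]
  exact hv

/-- Through every point that lies in slices of both directions there is a cross. -/
lemma exists_cross (hP : IsOrthogonalPolygon P) {rep : Dir → Set (ℝ × ℝ) → Seg}
    (hrep : IsSelection P k rep) {p : ℝ × ℝ} (hp : ∀ d, p ∈ cutInterior P k d) :
    ∃ c : Cross P k rep, ∀ d, p ∈ c.slice d := by
  set σ : Dir → Set (ℝ × ℝ) := fun d => connectedComponentIn (cutInterior P k d) p with hσdef
  have hσ : ∀ d, IsSlice P k d (σ d) := fun d => ⟨p, hp d, rfl⟩
  have hpσ : ∀ d, p ∈ σ d := fun d => mem_connectedComponentIn (hp d)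
  have hpP : p ∈ P := interior_subset (hp .horizontal).1
  have hmem : ∀ d, pt d (rep d (σ d)).level (rep d.perp (σ d.perp)).level ∈
      extension P k (rep d (σ d)) := by
    intro d
    refine Visible.mem_extension_of_isSlice hP hrep (hσ d) (hpσ d) (visible_of_uIcc_subset ?_)
    obtain ⟨hd, hsub⟩ := hrep _ _ (hσ d.perp)
    set r := rep d.perp (σ d.perp) with hr
    -- `p` sees itself in the perpendicular direction. So, moving across the perpendicular slice,
    -- one stays in `P` from `p` to the level of the other selected segment, and the intended cross
    -- is visible from `p`.
    have hself : Visible P k d.perp p (coord d.perp p) := by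
      refine visible_of_uIcc_subset ?_
      rw [uIcc_self, singleton_subset_iff, mem_line, pt_coord]
      exact hpP
    have := (hσ d.perp).uIcc_subset_line hP (hpσ d.perp) (hsub r.pt_lo_mem_carrier) hself
    rw [hd, coord_perp_pt, Dir.perp_perp] at this
    exact this
  refine ⟨⟨σ, hσ, ⟨p, hpσ _, hpσ _⟩, pt .horizontal (rep .horizontal (σ .horizontal)).level
    (rep .vertical (σ .vertical)).level, fun d => ?_⟩, hpσ⟩
  have := hmem d
  cases d
  · exact this
  · exact this

end SlidingTransmitter

open SlidingTransmitter in
theorem mainTheorem3 (P : Set (ℝ × ℝ)) (hP : SlidingTransmitter.IsOrthogonalPolygon P) (k m : ℕ)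
    (rep : SlidingTransmitter.Dir → Set (ℝ × ℝ) → SlidingTransmitter.Seg)
    (hrep : SlidingTransmitter.IsSelection P k rep) :
    (∃ S : Finset SlidingTransmitter.Seg, S.card ≤ m ∧
        (∀ s ∈ S, SlidingTransmitter.IsTransmitter P s) ∧ SlidingTransmitter.Guards P k S) ↔
      ∃ S' : Finset SlidingTransmitter.Seg, S'.card ≤ m ∧
        (∀ g ∈ S', SlidingTransmitter.IsGuardSegment P g) ∧
        ∀ c : SlidingTransmitter.Cross P k rep, ∃ g ∈ S', c.HitBy g := by
  classical
  constructor
  · rintro ⟨S, hcard, hS, hguard⟩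
    have hex : ∀ s : Seg, ∃ g, s ∈ S → IsGuardSegment P g ∧ g.dir = s.dir ∧
        Set.Icc s.lo s.hi ⊆ Set.Icc g.lo g.hi ∧
        ∀ t ∈ Set.Icc s.lo s.hi, Set.uIcc s.level g.level ⊆ line P s.dir.perp t := by
      intro s
      by_cases hs : s ∈ S
      · obtain ⟨g, hg⟩ := (hS s hs).exists_guardSegment hP
        exact ⟨g, fun _ => hg⟩
      · exact ⟨s, fun h => absurd h hs⟩
    choose G hG using hex
    refine ⟨S.image G, Finset.card_image_le.trans hcard, ?_, fun c => ?_⟩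
    · intro g hg
      obtain ⟨s, hs, rfl⟩ := Finset.mem_image.1 hg
      exact (hG s hs).1
    -- Any one point of the pixel suffices, since a guard-segment seeing it already hits the cross.
    · obtain ⟨p, hpH, hpV⟩ := c.pixel_nonempty
      have hpσ : ∀ d, p ∈ c.slice d := by
        intro d
        cases d
        exacts [hpH, hpV]
      have hpP : p ∈ P := interior_subset ((c.isSlice _).subset_cutInterior hpH).1
      obtain ⟨s, hs, hsee⟩ := hguard p hpP
      rw [sees_iff hpP fun h => hS s hs (Set.mem_image_of_mem _ h)] at hsee
      obtain ⟨hg, hdir, hsub, hline⟩ := hG s hs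
      refine ⟨G s, Finset.mem_image_of_mem _ hs, c.hitBy_of_visible hP hrep hg (hpσ _) ?_ ?_⟩
      · rw [hdir]
        exact hsub hsee.1
      · rw [hdir]
        refine hsee.2.move_right ?_
        rw [Dir.perp_perp]
        exact hline _ hsee.1
  · rintro ⟨S, hcard, hS, hhit⟩
    refine ⟨S, hcard, fun g hg => (hS g hg).2.1, fun p hp => ?_⟩
    -- The guarded set is closed, so only the dense set of points in slices of both directions has
    -- to be checked.
    have hcl : IsClosed {p | ∃ s ∈ S, Sees P k s p} := by
      have : {p | ∃ s ∈ S, Sees P k s p} = ⋃ s ∈ S, {p | Sees P k s p} := by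
        ext
        simp
      rw [this]
      exact S.finite_toSet.isClosed_biUnion fun s _ => isClosed_setOf_sees hP.isCompact.isClosed s
    refine closure_minimal ?_ hcl (hP.subset_closure_cutInterior k hp)
    intro q hq
    obtain ⟨c, hc⟩ := exists_cross hP hrep hq
    obtain ⟨g, hg, hgc⟩ := hhit c
    exact ⟨g, hg, (hS g hg).sees_of_nonempty_inter hP hrep (c.isSlice _) hgc (hc _)⟩
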